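/- Consider a simple polygon $P$, regarded as a closed region in the plane. Two points see each other in $P$ if the segment between them is contained in $P$. A boundary guard is a point on the boundary of $P$, and a set of guards guards a set $T$ if every point of $T$ is seen by at least one of the guards. A nook of $P$ is a chain of three consecutive edges such that the open segment joining the two ends of the chain lies in the interior of $P$. (1) For real numbers $x,y,z$ with $-4<x<4$, the four constraints $$z\ge x,\qquad y\ge z,\qquad \frac{4x+2}{x+4}\ge y,\qquad \frac{4x-2}{-x+4}\ge y$$ hold if and only if $x=y=z=\sqrt2$ or $x=y=z=-\sqrt2$. (2) There is a simple polygon $P$ with integer vertices whose boundary can be guarded by $3$ boundary guards, but by at most $3$ boundary guards only if each of them has an irrational coordinate. More precisely, there are such a polygon $P$, a scaling factor $N\in\mathbb{Z}_{>0}$, intervals $I_x,I_y,I_z\subset(0,\infty)$ with rational end points and with $\sqrt2$ in their interiors, where $I_x\subset(0,4)$, and four pairwise disjoint nooks of $P$, such that, writing $$X(x)=N\,(-x,\,0),\qquad Y(y)=N\left(\tfrac32+\tfrac12y,\;1+y\right),\qquad Z(z)=N\left(\tfrac32+\tfrac12z,\;-1-z\right),$$ the following hold. (a) For all $x\in I_x$,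 $y\in I_y$, $z\in I_z$ the points $X(x),Y(y),Z(z)$ lie on the boundary of $P$. (b) For all $x\in I_x$, $y\in I_y$, $z\in I_z$: the first nook is guarded by $X(x)$ and $Z(z)$ if and only if $z\ge x$; the second is guarded by $Y(y)$ and $Z(z)$ if and only if $y\ge z$; the third is guarded by $X(x)$ and $Y(y)$ if and only if $\frac{4x+2}{x+4}\ge y$; and the fourth is guarded by $X(x)$ and $Y(y)$ if and only if $\frac{4x-2}{-x+4}\ge y$. Each of the four equivalences remains true if the remaining one of the three guards $X(x),Y(y),Z(z)$ is added. (c) A set $G$ of at most $3$ points is a set of boundary guards that guards the whole boundary of $P$ if and only if $G=\{X(x),Y(y),Z(z)\}$ for some $x\in I_x$, $y\in I_y$, $z\in I_z$ that satisfy the four constraints. (d) Consequently these constraints force $x=y=z=\sqrt2$: the set $\{X(\sqrt2),Y(\sqrt2),Z(\sqrt2)\}$ is the only set of at most $3$ boundary guards that guards the boundary of $P$. It has exactly $3$ elements, and each of them has an irrational coordinate. -/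

import Mathlib

/-- A polygon in the plane is simple if it has at least three vertices, the vertices are pairwise
distinct, and two different edges meet at most in common end points. -/
def Polygon.IsSimplePlane {n : ℕ} (P : Polygon (ℝ × ℝ) n) : Prop :=
  3 ≤ n ∧ Function.Injective P.vertices ∧
    ∀ i j : Fin n, i ≠ j →
      P.edgeSet ℝ i ∩ P.edgeSet ℝ j ⊆
        ({P i, P (finRotate n i)} : Set (ℝ × ℝ)) ∩ {P j, P (finRotate n j)}

/-- All vertices of the polygon have integer coordinates. -/
def Polygon.HasIntegerVertices {n : ℕ} (P : Polygon (ℝ × ℝ) n) : Prop :=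
  ∀ i : Fin n, ∃ a b : ℤ, P i = ((a : ℝ), (b : ℝ))

/-- The closed region enclosed by a polygon: its boundary together with the points whose connected
component in the complement of the boundary is bounded. -/
def Polygon.closedRegion {n : ℕ} (P : Polygon (ℝ × ℝ) n) : Set (ℝ × ℝ) :=
  {p | p ∈ P.boundary ℝ ∨ Bornology.IsBounded (connectedComponentIn (P.boundary ℝ)ᶜ p)}

/-- Two points see each other in the polygon if the line segment between them lies in it. -/
def Polygon.Sees {n : ℕ} (P : Polygon (ℝ × ℝ) n) (p q : ℝ × ℝ) : Prop :=
  segment ℝ p q ⊆ P.closedRegion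

/-- Every point of `T` is seen by at least one guard in `G`. -/
def Polygon.Guards {n : ℕ} (P : Polygon (ℝ × ℝ) n) (G T : Set (ℝ × ℝ)) : Prop :=
  ∀ t ∈ T, ∃ g ∈ G, P.Sees g t

/-- `G` is a set of guards placed on the boundary which together see the whole boundary. -/
def Polygon.IsBoundaryGuarding {n : ℕ} (P : Polygon (ℝ × ℝ) n) (G : Set (ℝ × ℝ)) : Prop :=
  G ⊆ P.boundary ℝ ∧ P.Guards G (P.boundary ℝ)

/-- The three consecutive edges of the polygon starting at the vertex with index `s`. -/
def Polygon.threeEdges {n : ℕ} (P : Polygon (ℝ × ℝ) n) (s : Fin n) : Set (ℝ × ℝ) :=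
  P.edgeSet ℝ s ∪ P.edgeSet ℝ (finRotate n s) ∪ P.edgeSet ℝ (finRotate n (finRotate n s))

/-- Four consecutive vertices (the first one with index `s`) form a nook if the open segment
joining the first to the last one (the mouth of the nook) lies in the interior of the polygon.
The walls of the nook are the three edges `P.threeEdges s`. -/
def Polygon.IsNook {n : ℕ} (P : Polygon (ℝ × ℝ) n) (s : Fin n) : Prop :=
  openSegment ℝ (P s) (P (finRotate n (finRotate n (finRotate n s)))) ⊆
    P.closedRegion \ P.boundary ℝ

/-- The condition `C` is exactly what the nook starting at `s` demands from the guards at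
`g₁` and `g₂`: these two guards see the walls of the nook if and only if `C` holds, and the presence
of the third guard at `g₃` does not change this. -/
def Polygon.NookImposes {n : ℕ} (P : Polygon (ℝ × ℝ) n) (s : Fin n) (g₁ g₂ g₃ : ℝ × ℝ)
    (C : Prop) : Prop :=
  (P.Guards {g₁, g₂} (P.threeEdges s) ↔ C) ∧ (P.Guards {g₁, g₂, g₃} (P.threeEdges s) ↔ C)

/-- The position of a guard representing the value `x`, in a drawing scaled by `N`. -/
noncomputable def guardX (N : ℕ) (x : ℝ) : ℝ × ℝ := (N : ℝ) • (-x, 0)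

/-- The position of a guard representing the value `y`, in a drawing scaled by `N`. -/
noncomputable def guardY (N : ℕ) (y : ℝ) : ℝ × ℝ := (N : ℝ) • (3 / 2 + 1 / 2 * y, 1 + y)

/-- The position of a guard representing the value `z`, in a drawing scaled by `N`. -/
noncomputable def guardZ (N : ℕ) (z : ℝ) : ℝ × ℝ := (N : ℝ) • (3 / 2 + 1 / 2 * z, -1 - z)

/-- The conjunction of the four constraints created by the nooks. -/
def NookConstraints (x y z : ℝ) : Prop :=
  z ≥ x ∧ y ≥ z ∧ (4 * x + 2) / (x + 4) ≥ y ∧ (4 * x - 2) / (-x + 4) ≥ y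

/-!
The gallery is an explicit polygon with integer vertices. It has five nooks and three distinguished
edges, such that some point on the base of each of the nooks `i` and `i + 1` sees nothing of the
boundary outside its own nook except the edge `i`. A set of guards therefore meets, for each `i`,
the edge `i` or both of the nooks `i` and `i + 1`. As the first four nooks and the three edges are
pairwise disjoint, three guards can only achieve this with one guard on each of the edges, where
they represent values of `x`, `z` and `y`.

Two guards who look into a nook from opposite sides see all of it except for an initial and a final
part of its base, and they see the nook unless these parts overlap. Whether a point of the base is
hidden is decided by the sign of an affine function of that point, and an identity between the two
functions shows that the overlap has the sign of the constraint. The constraints imply `x ≤ z ≤ y`,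
so that `x * (x + 4) ≤ 4 * x + 2` and `x * (4 - x) ≤ 4 * x - 2`, that is `x ^ 2 = 2`.

A point is outside the polygon if it can move to infinity without meeting the boundary. A point is
inside if it can be joined to the union of a triangulation without meeting the boundary, because the
union is relatively clopen in the complement of the boundary. Both criteria amount to the signs of
finitely many integer determinants.
-/

namespace ArtGallery

open AffineMap Filter Set Topology

/-! ### Orientation -/

section Orientation

variable {R : Type*} [CommRing R]

/-- Twice the signed area of the triangle `a b p`: it is positive if `p` lies to the left of the
line directed from `a` to `b`. -/
def orient (a b p : R × R) : R := (b.1 - a.1) * (p.2 - a.2) - (b.2 - a.2) * (p.1 - a.1)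

theorem orient_rotate (a b p : R × R) : orient b p a = orient a b p := by
  simp only [orient]; ring

theorem orient_swap (a b p : R × R) : orient b a p = -orient a b p := by
  simp only [orient]; ring

@[simp]
theorem orient_self_left (a b : R × R) : orient a b a = 0 := by
  simp only [orient]; ring

@[simp]
theorem orient_self_right (a b : R × R) : orient a b b = 0 := by
  simp only [orient]; ring

theorem orient_add_orient_add_orient (a b c p : R × R) :
    orient b c p + orient c a p + orient a b p = orient a b c := by
  simp only [orient]; ring

theorem orient_smul_eq (a b c p : R × R) :
    orient a b c • p = orient b c p • a + orient c a p • b + orient a b p • c := by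
  ext <;> simp only [orient, Prod.fst_add, Prod.snd_add, Prod.smul_fst, Prod.smul_snd,
    smul_eq_mul] <;> ring

theorem orient_mul_orient (a b c p u v : R × R) :
    orient a b c * orient u v p =
      orient b c p * orient u v a + orient c a p * orient u v b + orient a b p * orient u v c := by
  simp only [orient]; ring

end Orientation

section Plane

variable {a b c p q u v x : ℝ × ℝ} {t : ℝ}

/-- `orient a b` as an affine function. -/
def orientMap (a b : ℝ × ℝ) : ℝ × ℝ →ᵃ[ℝ] ℝ where
  toFun := orient a b
  linear := (b.1 - a.1) • LinearMap.snd ℝ ℝ ℝ - (b.2 - a.2) • LinearMap.fst ℝ ℝ ℝ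
  map_vadd' p v := by simp [orient]; ring

theorem orient_lineMap (a b p q : ℝ × ℝ) (t : ℝ) :
    orient a b (lineMap p q t) = (1 - t) * orient a b p + t * orient a b q :=
  ((orientMap a b).apply_lineMap p q t).trans (lineMap_apply_ring _ _ _)

theorem continuous_orient (a b : ℝ × ℝ) : Continuous (orient a b) := by
  unfold orient; fun_prop

theorem orient_mem_of_mem_convexHull {s : Set (ℝ × ℝ)} {I : Set ℝ} (hI : Convex ℝ I)
    (h : ∀ k ∈ s, orient u v k ∈ I) (hp : p ∈ convexHull ℝ s) : orient u v p ∈ I :=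
  convexHull_min h (hI.affine_preimage (orientMap u v)) hp

theorem orient_mem_of_mem_segment {I : Set ℝ} (hI : Convex ℝ I) (hp : orient u v p ∈ I)
    (hq : orient u v q ∈ I) (hx : x ∈ segment ℝ p q) : orient u v x ∈ I :=
  (hI.affine_preimage (orientMap u v)).segment_subset hp hq hx

theorem orient_eq_zero_of_mem_segment (hx : x ∈ segment ℝ a b) : orient a b x = 0 :=
  orient_mem_of_mem_segment (convex_singleton 0) (orient_self_left a b) (orient_self_right a b) hx

theorem lineMap_mem_segment (ht : t ∈ Icc 0 1) : lineMap p q t ∈ segment ℝ p q := by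
  rw [segment_eq_image_lineMap]; exact mem_image_of_mem _ ht

theorem lineMap_mem_openSegment (ht : t ∈ Ioo 0 1) : lineMap p q t ∈ openSegment ℝ p q := by
  rw [openSegment_eq_image_lineMap]; exact mem_image_of_mem _ ht

theorem segment_inter_segment_nonempty (hp : 0 ≤ orient a b p) (hq : orient a b q < 0)
    (ha : orient p q a ≤ 0) (hb : 0 ≤ orient p q b) :
    (segment ℝ a b ∩ segment ℝ p q).Nonempty := by
  have hD : orient p q b - orient p q a = orient a b p - orient a b q := by
    simp only [orient]; ring
  have hD₀ : 0 < orient a b p - orient a b q := by linarith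
  have hx : lineMap a b (-orient p q a / (orient a b p - orient a b q)) =
      lineMap p q (orient a b p / (orient a b p - orient a b q)) := by
    have hne := hD₀.ne'
    ext <;> simp only [lineMap_apply_module, Prod.fst_add, Prod.snd_add, Prod.smul_fst,
      Prod.smul_snd, smul_eq_mul] <;> field_simp <;> simp only [orient] <;> ring
  refine ⟨_, lineMap_mem_segment ⟨?_, ?_⟩, hx.symm ▸ lineMap_mem_segment ⟨?_, ?_⟩⟩
  · exact div_nonneg (by linarith) hD₀.le
  · rw [div_le_one hD₀]; linarith
  · exact div_nonneg hp hD₀.le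
  · rw [div_le_one hD₀]; linarith

theorem openSegment_inter_segment_nonempty (hp : 0 ≤ orient a b p) (hq : orient a b q < 0)
    (ha : orient p q a < 0) (hb : 0 < orient p q b) :
    (openSegment ℝ a b ∩ segment ℝ p q).Nonempty := by
  obtain ⟨x, hx, hx'⟩ := segment_inter_segment_nonempty hp hq ha.le hb.le
  have h₀ := orient_eq_zero_of_mem_segment hx'
  refine ⟨x, mem_openSegment_of_ne_left_right ?_ ?_ hx, hx'⟩
  · rintro rfl; exact ha.ne h₀
  · rintro rfl; exact hb.ne' h₀

/-! ### Edges from which one can escape to infinity -/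

section Polygon

variable {m : ℕ} {P : Polygon (ℝ × ℝ) (m + 1)} {i : Fin (m + 1)} {d : ℝ × ℝ}

theorem edgeSet_eq_segment (P : Polygon (ℝ × ℝ) (m + 1)) (i : Fin (m + 1)) :
    P.edgeSet ℝ i = segment ℝ (P i) (P (i + 1)) := by
  rw [Polygon.edgeSet, affineSegment_eq_segment, finRotate_apply]

theorem mem_boundary_iff : p ∈ P.boundary ℝ ↔ ∃ i, p ∈ segment ℝ (P i) (P (i + 1)) := by
  simp only [Polygon.boundary, mem_iUnion, edgeSet_eq_segment]

theorem edge_subset_boundary (P : Polygon (ℝ × ℝ) (m + 1)) (i : Fin (m + 1)) :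
    segment ℝ (P i) (P (i + 1)) ⊆ P.boundary ℝ :=
  fun _ hp => mem_boundary_iff.2 ⟨i, hp⟩

theorem sees_comm : P.Sees p q ↔ P.Sees q p := by
  rw [Polygon.Sees, Polygon.Sees, segment_symm]

/-- The open half-strip that starts at the segment from `a` to `b`, lies to the right of it and is
unbounded in the direction `d`. -/
def strip (a b d : ℝ × ℝ) : Set (ℝ × ℝ) :=
  {p | 0 < orient b a p ∧ 0 < orient a (a + d) p ∧ 0 < orient (b + d) b p}

/-- From the right side of the edge `i`, which is the outer side of a polygon in counterclockwise
order, one can move to infinity in the direction `d` without meeting the boundary again. -/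
def IsEscape (P : Polygon (ℝ × ℝ) (m + 1)) (i : Fin (m + 1)) (d : ℝ × ℝ) : Prop :=
  0 < orient (P (i + 1)) (P i) (P i + d) ∧ Disjoint (strip (P i) (P (i + 1)) d) (P.boundary ℝ)

theorem add_smul_mem_strip (hd : 0 < orient b a (a + d)) (hp : p ∈ strip a b d) (ht : 0 ≤ t) :
    p + t • d ∈ strip a b d := by
  obtain ⟨h₁, h₂, h₃⟩ := hp
  refine ⟨?_, h₂.trans_eq ?_, h₃.trans_eq ?_⟩
  · have : orient b a (p + t • d) = orient b a p + t * orient b a (a + d) := by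
      simp [orient]; ring
    rw [this]; positivity
  · simp [orient]; ring
  · simp [orient]; ring

theorem tendsto_add_smul_cobounded (p : ℝ × ℝ) (hd : d ≠ 0) :
    Tendsto (fun t : ℝ => p + t • d) atTop (Bornology.cobounded (ℝ × ℝ)) := by
  rw [← tendsto_norm_atTop_iff_cobounded]
  refine tendsto_atTop_mono (f := fun t : ℝ => -‖p‖ + t * ‖d‖) (fun t => ?_) <|
    tendsto_atTop_add_const_left _ _ (tendsto_id.atTop_mul_const (norm_pos_iff.2 hd))
  have h₁ : ‖t • d‖ ≤ ‖p + t • d‖ + ‖p‖ := by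
    simpa using norm_sub_le (p + t • d) p
  have h₂ : t * ‖d‖ ≤ ‖t • d‖ := by
    rw [norm_smul]; gcongr; exact le_abs_self t
  linarith

theorem notMem_closedRegion_of_mem_strip (h : IsEscape P i d)
    (hp : p ∈ strip (P i) (P (i + 1)) d) : p ∉ P.closedRegion := by
  obtain ⟨hd, hdisj⟩ := h
  have hray : (fun t : ℝ => p + t • d) '' Ici 0 ⊆ connectedComponentIn (P.boundary ℝ)ᶜ p := by
    refine ((convex_Ici (0 : ℝ)).isPreconnected.image _ (by fun_prop)).subset_connectedComponentIn
      ⟨0, by simp, by simp⟩ ?_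
    rintro _ ⟨t, ht, rfl⟩
    exact disjoint_left.1 hdisj (add_smul_mem_strip hd hp ht)
  rintro (hb | hb)
  · exact disjoint_left.1 hdisj hp hb
  have hd₀ : d ≠ 0 := by
    rintro rfl; simp at hd
  obtain ⟨t, ht₀, ht⟩ := ((eventually_ge_atTop 0).and <|
    (tendsto_add_smul_cobounded p hd₀).eventually (hb.subset hray)).exists
  exact ht (mem_image_of_mem _ ht₀)

/-! ### Obstructed lines of sight -/

/-- The points of the segment from `x` to `q` that are close to `x` but different from it lie to
the left of the line from `a` to `b`. -/
def EntersLeft (a b x q : ℝ × ℝ) : Prop :=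
  0 < orient a b x ∨ orient a b x = 0 ∧ 0 < orient a b q

theorem EntersLeft.eventually (h : EntersLeft a b x q) :
    ∀ᶠ t in 𝓝[>] (0 : ℝ), 0 < orient a b (lineMap x q t) := by
  rcases h with h | ⟨h₀, h⟩
  · have hc : Continuous fun t : ℝ => orient a b (lineMap x q t) :=
      (continuous_orient a b).comp lineMap_continuous
    refine (hc.tendsto 0).mono_left nhdsWithin_le_nhds |>.eventually_const_lt ?_
    rwa [lineMap_apply_zero]
  · filter_upwards [self_mem_nhdsWithin] with t ht
    rw [orient_lineMap, h₀]
    simpa using mul_pos ht h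

theorem not_sees_of_enters_strip (h : IsEscape P i d) (hx : x ∈ segment ℝ p q)
    (h₁ : EntersLeft (P (i + 1)) (P i) x q) (h₂ : EntersLeft (P i) (P i + d) x q)
    (h₃ : EntersLeft (P (i + 1) + d) (P (i + 1)) x q) : ¬ P.Sees p q := by
  intro hs
  obtain ⟨t, ht₁, ht₂, ht₃, ht⟩ := (h₁.eventually.and <| h₂.eventually.and <|
    h₃.eventually.and <| Ioo_mem_nhdsGT one_pos).exists
  refine notMem_closedRegion_of_mem_strip h ⟨ht₁, ht₂, ht₃⟩ (hs ?_)
  exact (convex_segment p q).segment_subset hx (right_mem_segment ℝ p q)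
    (lineMap_mem_segment ⟨ht.1.le, ht.2.le⟩)

theorem not_sees_of_mem_openSegment (h : IsEscape P i d)
    (hx : x ∈ openSegment ℝ (P i) (P (i + 1))) (hxpq : x ∈ segment ℝ p q)
    (hq : orient (P i) (P (i + 1)) q < 0) : ¬ P.Sees p q := by
  have hx₀ := orient_eq_zero_of_mem_segment (openSegment_subset_segment ℝ _ _ hx)
  rw [openSegment_eq_image_lineMap] at hx
  obtain ⟨t, ⟨ht₀, ht₁⟩, rfl⟩ := hx
  have hd := h.1
  have e₁ : orient (P i) (P i + d) (P (i + 1)) = orient (P (i + 1)) (P i) (P i + d) := by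
    rw [orient_rotate]
  have e₂ : orient (P (i + 1) + d) (P (i + 1)) (P i) = orient (P (i + 1)) (P i) (P i + d) := by
    simp only [orient, Prod.fst_add, Prod.snd_add]; ring
  refine not_sees_of_enters_strip h hxpq (.inr ⟨?_, ?_⟩) (.inl ?_) (.inl ?_)
  · rw [orient_swap, hx₀, neg_zero]
  · rw [orient_swap]; linarith
  · rw [orient_lineMap, orient_self_left, e₁, mul_zero, zero_add]; positivity
  · have := sub_pos.2 ht₁
    rw [orient_lineMap, orient_self_right, e₂, mul_zero, add_zero]; positivity

theorem not_sees_of_crosses (h : IsEscape P i d) (hp : 0 ≤ orient (P i) (P (i + 1)) p)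
    (hq : orient (P i) (P (i + 1)) q < 0) (hi : orient p q (P i) < 0)
    (hi' : 0 < orient p q (P (i + 1))) : ¬ P.Sees p q := by
  obtain ⟨x, hx, hxpq⟩ := openSegment_inter_segment_nonempty hp hq hi hi'
  exact not_sees_of_mem_openSegment h hx hxpq hq

/-! ### Triangulated polygons -/

/-- A set of counterclockwise triangles, given by the indices of their vertices in each of the three
cyclic orders, in which each side is an edge of the polygon or the side of a triangle on its other
side. -/
def IsTriangulation (P : Polygon (ℝ × ℝ) (m + 1))
    (T : Set (Fin (m + 1) × Fin (m + 1) × Fin (m + 1))) : Prop :=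
  ∀ a b c, (a, b, c) ∈ T →
    (b, c, a) ∈ T ∧ 0 < orient (P a) (P b) (P c) ∧ (b = a + 1 ∨ ∃ d, (b, a, d) ∈ T)

/-- The closed triangle with the given vertices in counterclockwise order. -/
def triangle (a b c : ℝ × ℝ) : Set (ℝ × ℝ) :=
  {p | 0 ≤ orient a b p ∧ 0 ≤ orient b c p ∧ 0 ≤ orient c a p}

/-- The union of the triangles in `T`. -/
def triangleUnion (P : Polygon (ℝ × ℝ) (m + 1))
    (T : Set (Fin (m + 1) × Fin (m + 1) × Fin (m + 1))) : Set (ℝ × ℝ) :=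
  ⋃ t ∈ T, triangle (P t.1) (P t.2.1) (P t.2.2)

variable {T : Set (Fin (m + 1) × Fin (m + 1) × Fin (m + 1))}

theorem isClosed_triangleUnion : IsClosed (triangleUnion P T) :=
  T.toFinite.isClosed_biUnion fun _ _ =>
    (isClosed_le continuous_const (continuous_orient _ _)).inter <|
      (isClosed_le continuous_const (continuous_orient _ _)).inter <|
        isClosed_le continuous_const (continuous_orient _ _)

theorem triangle_subset_convexHull (h : 0 < orient a b c) :
    triangle a b c ⊆ convexHull ℝ {a, b, c} := by
  rintro p ⟨h₁, h₂, h₃⟩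
  have hsum := orient_add_orient_add_orient a b c p
  have hmem := Finset.univ.centerMass_mem_convexHull (R := ℝ) (s := {a, b, c})
    (w := ![orient b c p, orient c a p, orient a b p]) (z := ![a, b, c])
    (by simp [Fin.forall_fin_succ, h₁, h₂, h₃]) (by simpa [Fin.sum_univ_three, hsum])
    (by simp [Fin.forall_fin_succ])
  simpa [Finset.centerMass, Fin.sum_univ_three, hsum, ← orient_smul_eq, smul_smul, h.ne']
    using hmem

theorem isBounded_triangleUnion (hT : IsTriangulation P T) :
    Bornology.IsBounded (triangleUnion P T) := by
  refine (isBounded_convexHull (s := range P).2 (finite_range P).isBounded).subset <|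
    iUnion₂_subset fun ⟨a, b, c⟩ ht =>
    (triangle_subset_convexHull (hT a b c ht).2.1).trans (convexHull_mono ?_)
  simp [insert_subset_iff]

theorem eventually_orient_pos (h : 0 < orient u v p) : ∀ᶠ q in 𝓝 p, 0 < orient u v q :=
  ((continuous_orient u v).tendsto p).eventually_const_lt h

theorem eq_of_orient_eq_zero (h : orient a b c ≠ 0) (h₁ : orient a b p = 0)
    (h₂ : orient c a p = 0) : p = a := by
  have hs := orient_smul_eq a b c p
  have h₃ := orient_add_orient_add_orient a b c p
  simp only [h₁, h₂, add_zero, zero_smul] at hs h₃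
  exact smul_right_injective _ h (h₃ ▸ hs)

theorem eq_lineMap_of_orient_eq_zero (h : orient a b c ≠ 0) (h₁ : orient a b p = 0) :
    p = lineMap a b (orient c a p / orient a b c) := by
  have hs := orient_smul_eq a b c p
  have hsum := orient_add_orient_add_orient a b c p
  rw [h₁, add_zero] at hsum
  rw [h₁, zero_smul, add_zero, eq_sub_of_add_eq hsum] at hs
  refine smul_right_injective _ h (hs.trans ?_)
  beta_reduce
  rw [lineMap_apply_module, smul_add, smul_smul, smul_smul, mul_sub, mul_one, mul_div_cancel₀ _ h]

theorem triangleUnion_mem_nhds_of_orient_eq_zero (hT : IsTriangulation P T) {a b c : Fin (m + 1)}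
    (ht : (a, b, c) ∈ T) (hp : p ∉ P.boundary ℝ) (h₁ : orient (P a) (P b) p = 0)
    (h₂ : 0 < orient (P b) (P c) p) (h₃ : 0 < orient (P c) (P a) p) :
    triangleUnion P T ∈ 𝓝 p := by
  obtain ⟨-, habc, hab⟩ := hT a b c ht
  obtain rfl | ⟨d, hd⟩ := hab
  · have hsum := orient_add_orient_add_orient (P a) (P (a + 1)) (P c) p
    refine absurd (edge_subset_boundary P a ?_) hp
    rw [eq_lineMap_of_orient_eq_zero habc.ne' h₁]
    exact lineMap_mem_segment ⟨by positivity, by rw [div_le_one habc]; linarith⟩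
  obtain ⟨-, hbad, -⟩ := hT b a d hd
  have had : 0 < orient (P a) (P d) p := by
    have := orient_mul_orient (P a) (P b) (P c) p (P a) (P d)
    rw [h₁, orient_self_left, mul_zero, zero_mul, zero_add, add_zero,
      orient_rotate (P b)] at this
    exact pos_of_mul_pos_right (this ▸ mul_pos h₃ hbad) habc.le
  have hdb : 0 < orient (P d) (P b) p := by
    have := orient_mul_orient (P a) (P b) (P c) p (P d) (P b)
    rw [h₁, orient_self_right, mul_zero, zero_mul, add_zero, add_zero,
      ← orient_rotate (P d) (P b) (P a)] at this
    exact pos_of_mul_pos_right (this ▸ mul_pos h₂ hbad) habc.le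
  filter_upwards [eventually_orient_pos h₂, eventually_orient_pos h₃, eventually_orient_pos had,
    eventually_orient_pos hdb] with q q₁ q₂ q₃ q₄
  rcases le_total 0 (orient (P a) (P b) q) with hq | hq
  · exact mem_biUnion ht ⟨hq, q₁.le, q₂.le⟩
  · exact mem_biUnion hd ⟨by rw [orient_swap]; linarith, q₃.le, q₄.le⟩

theorem triangleUnion_mem_nhds (hT : IsTriangulation P T) (hpT : p ∈ triangleUnion P T)
    (hp : p ∉ P.boundary ℝ) : triangleUnion P T ∈ 𝓝 p := by
  simp only [triangleUnion, mem_iUnion₂] at hpT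
  obtain ⟨⟨a, b, c⟩, ht, h₁, h₂, h₃⟩ := hpT
  obtain ⟨ht', habc, -⟩ := hT a b c ht
  obtain ⟨ht'', hbca, -⟩ := hT b c a ht'
  obtain ⟨-, hcab, -⟩ := hT c a b ht''
  have hne : ∀ i, p ≠ P i := by
    rintro i rfl; exact hp (edge_subset_boundary P i (left_mem_segment ℝ _ _))
  have hab : orient (P a) (P b) p = 0 → orient (P c) (P a) p ≠ 0 :=
    fun h h' => hne a (eq_of_orient_eq_zero habc.ne' h h')
  have hbc : orient (P b) (P c) p = 0 → orient (P a) (P b) p ≠ 0 :=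
    fun h h' => hne b (eq_of_orient_eq_zero hbca.ne' h h')
  have hca : orient (P c) (P a) p = 0 → orient (P b) (P c) p ≠ 0 :=
    fun h h' => hne c (eq_of_orient_eq_zero hcab.ne' h h')
  simp only at h₁ h₂ h₃
  by_cases e₁ : orient (P a) (P b) p = 0
  · exact triangleUnion_mem_nhds_of_orient_eq_zero hT ht hp e₁
      (h₂.lt_of_ne' fun e => hbc e e₁) (h₃.lt_of_ne' (hab e₁))
  by_cases e₂ : orient (P b) (P c) p = 0
  · exact triangleUnion_mem_nhds_of_orient_eq_zero hT ht' hp e₂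
      (h₃.lt_of_ne' fun e => hca e e₂) (h₁.lt_of_ne' e₁)
  by_cases e₃ : orient (P c) (P a) p = 0
  · exact triangleUnion_mem_nhds_of_orient_eq_zero hT ht'' hp e₃ (h₁.lt_of_ne' e₁)
      (h₂.lt_of_ne' e₂)
  filter_upwards [eventually_orient_pos (h₁.lt_of_ne' e₁), eventually_orient_pos (h₂.lt_of_ne' e₂),
    eventually_orient_pos (h₃.lt_of_ne' e₃)] with q q₁ q₂ q₃
  exact mem_biUnion ht ⟨q₁.le, q₂.le, q₃.le⟩

theorem mem_closedRegion_of_isPreconnected (hT : IsTriangulation P T) (hc : c ∈ triangleUnion P T)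
    {S : Set (ℝ × ℝ)} (hS : IsPreconnected S) (hSP : Disjoint S (P.boundary ℝ)) (hcS : c ∈ S)
    (hpS : p ∈ S) : p ∈ P.closedRegion := by
  have hS' : S ⊆ (P.boundary ℝ)ᶜ := hSP.subset_compl_right
  right
  rw [← connectedComponentIn_eq (hS.subset_connectedComponentIn hcS hS' hpS)]
  refine (isBounded_triangleUnion hT).subset (Subset.trans ?_ interior_subset)
  refine isPreconnected_connectedComponentIn.subset_of_closure_inter_subset isOpen_interior
    ⟨c, mem_connectedComponentIn (hS' hcS),
      mem_interior_iff_mem_nhds.2 (triangleUnion_mem_nhds hT hc (hS' hcS))⟩ ?_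
  rintro x ⟨hx₁, hx₂⟩
  exact mem_interior_iff_mem_nhds.2 (triangleUnion_mem_nhds hT
    (isClosed_triangleUnion.closure_subset_iff.2 interior_subset hx₁)
    (connectedComponentIn_subset _ _ hx₂))

/-! ### Convex sets of mutually visible points -/

/-- `c` lies in the relative interior of the convex hull of `K`: it lies strictly on the left of
every line that weakly has `K` on its left without containing it. -/
def IsRelInner (K : Set (ℝ × ℝ)) (c : ℝ × ℝ) : Prop :=
  ∀ u v, (∀ k ∈ K, 0 ≤ orient u v k) → (∃ k ∈ K, 0 < orient u v k) → 0 < orient u v c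

/-- Some line separates the segment from `a` to `b` from the relative interior of the convex hull
of `K`. -/
def SeparatedFrom (K : Set (ℝ × ℝ)) (a b : ℝ × ℝ) : Prop :=
  ∃ u v, orient u v a ≤ 0 ∧ orient u v b ≤ 0 ∧ (∀ k ∈ K, 0 ≤ orient u v k) ∧
    ((∃ k ∈ K, 0 < orient u v k) ∨ orient u v a < 0 ∧ orient u v b < 0)

variable {K : Set (ℝ × ℝ)}

theorem isRelInner_of_mem_openSegment (hc : c ∈ openSegment ℝ a b) : IsRelInner {a, b} c := by
  rw [openSegment_eq_image_lineMap] at hc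
  obtain ⟨t, ⟨ht₀, ht₁⟩, rfl⟩ := hc
  have ht₁' := sub_pos.2 ht₁
  simp only [IsRelInner, mem_insert_iff, mem_singleton_iff, forall_eq_or_imp, forall_eq,
    exists_eq_or_imp, exists_eq_left, orient_lineMap]
  rintro u v ⟨ha, hb⟩ (h | h) <;> positivity

theorem card_mul_orient_centroid {ι : Type*} [Fintype ι] [Nonempty ι] (u v : ℝ × ℝ)
    (w : ι → ℝ × ℝ) :
    Fintype.card ι * orient u v (Finset.univ.centroid ℝ w) = ∑ i, orient u v (w i) := by
  have hw : ∑ i, (Finset.univ : Finset ι).centroidWeights ℝ i = 1 :=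
    Finset.univ.sum_centroidWeights_eq_one_of_nonempty ℝ Finset.univ_nonempty
  have h := (Finset.univ.map_affineCombination w _ hw (orientMap u v)).trans
    (Finset.affineCombination_eq_linear_combination _ _ _ hw)
  refine (congrArg _ h).trans ?_
  simp [orientMap, ← Finset.mul_sum]

theorem isRelInner_centroid {ι : Type*} [Fintype ι] [Nonempty ι] (w : ι → ℝ × ℝ) :
    IsRelInner (range w) (Finset.univ.centroid ℝ w) := by
  simp only [IsRelInner, forall_mem_range, exists_range_iff]
  rintro u v h ⟨i, hi⟩
  have hsum := Finset.sum_pos' (fun i _ => h i) ⟨i, Finset.mem_univ i, hi⟩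
  exact pos_of_mul_pos_right (card_mul_orient_centroid u v w ▸ hsum) (Nat.cast_nonneg _)

theorem centroid_mem_convexHull_range {ι : Type*} [Fintype ι] [Nonempty ι] (w : ι → ℝ × ℝ) :
    Finset.univ.centroid ℝ w ∈ convexHull ℝ (range w) :=
  affineCombination_mem_convexHull (fun _ _ => by simp)
    (Finset.univ.sum_centroidWeights_eq_one_of_nonempty ℝ Finset.univ_nonempty)

theorem notMem_segment_of_separatedFrom (hc : IsRelInner K c) (hcK : c ∈ convexHull ℝ K)
    (h : SeparatedFrom K a b) (hp : p ∈ convexHull ℝ K) (ht₀ : 0 ≤ t) (ht₁ : t < 1) :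
    lineMap c p t ∉ segment ℝ a b := by
  obtain ⟨u, v, ha, hb, hK, h⟩ := h
  intro hx
  have hpK : 0 ≤ orient u v p := orient_mem_of_mem_convexHull (convex_Ici 0) hK hp
  have ht₁' := sub_pos.2 ht₁
  rcases h with h | ⟨ha, hb⟩
  · have h₁ : orient u v (lineMap c p t) ≤ 0 := orient_mem_of_mem_segment (convex_Iic 0) ha hb hx
    have h₂ := hc u v hK h
    have h₃ : 0 < orient u v (lineMap c p t) := by rw [orient_lineMap]; positivity
    exact h₁.not_gt h₃
  · have h₁ : orient u v (lineMap c p t) < 0 := orient_mem_of_mem_segment (convex_Iio 0) ha hb hx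
    have h₂ : 0 ≤ orient u v c := orient_mem_of_mem_convexHull (convex_Ici 0) hK hcK
    have h₃ : 0 ≤ orient u v (lineMap c p t) := by rw [orient_lineMap]; positivity
    exact h₃.not_gt h₁

theorem convexHull_subset_closedRegion (hT : IsTriangulation P T) (hc : IsRelInner K c)
    (hcK : c ∈ convexHull ℝ K) (hcT : c ∈ triangleUnion P T)
    (hP : ∀ i, SeparatedFrom K (P i) (P (i + 1))) : convexHull ℝ K ⊆ P.closedRegion := by
  intro p hp
  by_cases hpP : p ∈ P.boundary ℝ
  · exact Or.inl hpP
  refine mem_closedRegion_of_isPreconnected hT hcT (convex_segment c p).isPreconnected ?_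
    (left_mem_segment ℝ _ _) (right_mem_segment ℝ _ _)
  rw [disjoint_left, segment_eq_image_lineMap]
  rintro _ ⟨t, ⟨ht₀, ht₁⟩, rfl⟩ hx
  rcases ht₁.eq_or_lt with rfl | ht₁
  · exact hpP (by rwa [lineMap_apply_one] at hx)
  · obtain ⟨i, hi⟩ := mem_boundary_iff.1 hx
    exact notMem_segment_of_separatedFrom hc hcK (hP i) hp ht₀ ht₁ hi

theorem openSegment_disjoint_boundary (h : ∀ i, SeparatedFrom {a, b} (P i) (P (i + 1))) :
    Disjoint (openSegment ℝ a b) (P.boundary ℝ) := by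
  rw [disjoint_left]
  intro x hx hxP
  obtain ⟨i, hi⟩ := mem_boundary_iff.1 hxP
  have hx' : x ∈ convexHull ℝ {a, b} := by
    rw [convexHull_pair]; exact openSegment_subset_segment ℝ _ _ hx
  refine notMem_segment_of_separatedFrom (isRelInner_of_mem_openSegment hx) hx' (h i) hx' le_rfl
    one_pos ?_
  rwa [lineMap_apply_zero]

theorem isNook_of_convexHull_subset {s : Fin (m + 1)}
    (h : convexHull ℝ {P s, P (s + 1 + 1 + 1)} ⊆ P.closedRegion)
    (hP : ∀ i, SeparatedFrom {P s, P (s + 1 + 1 + 1)} (P i) (P (i + 1))) : P.IsNook s := by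
  intro x hx
  simp only [finRotate_apply] at hx
  refine ⟨h ?_, disjoint_left.1 (openSegment_disjoint_boundary hP) hx⟩
  rw [convexHull_pair]
  exact openSegment_subset_segment ℝ _ _ hx

theorem sees_of_convexHull_subset (h : convexHull ℝ K ⊆ P.closedRegion)
    (hp : p ∈ convexHull ℝ K) (hq : q ∈ convexHull ℝ K) : P.Sees p q :=
  ((convex_convexHull ℝ K).segment_subset hp hq).trans h

/-! ### Looking through the mouth of a nook -/

theorem segment_subset_segment_union (hx : x ∈ segment ℝ p q) :
    segment ℝ p q ⊆ segment ℝ p x ∪ segment ℝ x q := by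
  rw [segment_eq_image_lineMap] at hx
  rw [← insert_endpoints_openSegment, insert_subset_iff, insert_subset_iff]
  refine ⟨.inl (left_mem_segment ℝ _ _), .inr (right_mem_segment ℝ _ _), ?_⟩
  refine (openSegment_subset_union p q (image_subset_range _ _ hx)).trans <| insert_subset
    (.inl (right_mem_segment ℝ _ _)) (union_subset_union ?_ ?_) <;>
  exact openSegment_subset_segment ℝ _ _

theorem threeEdges_eq (P : Polygon (ℝ × ℝ) (m + 1)) (s : Fin (m + 1)) :
    P.threeEdges s = segment ℝ (P s) (P (s + 1)) ∪ segment ℝ (P (s + 1)) (P (s + 1 + 1)) ∪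
      segment ℝ (P (s + 1 + 1)) (P (s + 1 + 1 + 1)) := by
  simp only [Polygon.threeEdges, edgeSet_eq_segment, finRotate_apply]

theorem sees_through_segment {S T : Set (ℝ × ℝ)} (hS : S ⊆ P.closedRegion)
    (hT : T ⊆ P.closedRegion) (hSc : Convex ℝ S) (hTc : Convex ℝ T) (hpS : p ∈ S) (hqT : q ∈ T)
    (habS : segment ℝ a b ⊆ S) (habT : segment ℝ a b ⊆ T) (hp : 0 ≤ orient a b p)
    (hq : orient a b q < 0) (ha : orient p q a ≤ 0) (hb : 0 ≤ orient p q b) : P.Sees p q := by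
  obtain ⟨x, hxab, hx⟩ := segment_inter_segment_nonempty hp hq ha hb
  refine (segment_subset_segment_union hx).trans (union_subset ?_ ?_)
  · exact (hSc.segment_subset hpS (habS hxab)).trans hS
  · exact (hTc.segment_subset (habT hxab) hqT).trans hT

/-- The guards `a` and `b` look through the mouth of the nook `s` and together see its walls, except
possibly some points of its base (the middle one of the walls): of these, `a` can only miss points
hidden behind the last wall and `b` only points hidden behind the first one. -/
structure LookInto (P : Polygon (ℝ × ℝ) (m + 1)) (s : Fin (m + 1)) (a b : ℝ × ℝ) : Prop where
  nook_subset : convexHull ℝ {P s, P (s + 1), P (s + 1 + 1), P (s + 1 + 1 + 1)} ⊆ P.closedRegion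
  left_subset : convexHull ℝ {a, P (s + 1 + 1 + 1), P s} ⊆ P.closedRegion
  right_subset : convexHull ℝ {b, P (s + 1 + 1 + 1), P s} ⊆ P.closedRegion
  first_subset : convexHull ℝ {a, P s, P (s + 1)} ⊆ P.closedRegion
  last_subset : convexHull ℝ {b, P (s + 1 + 1), P (s + 1 + 1 + 1)} ⊆ P.closedRegion
  base_behind_mouth : 0 ≤ orient (P (s + 1 + 1 + 1)) (P s) (P (s + 1)) ∧
    0 ≤ orient (P (s + 1 + 1 + 1)) (P s) (P (s + 1 + 1))
  left_front : orient (P (s + 1 + 1 + 1)) (P s) a < 0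
  right_front : orient (P (s + 1 + 1 + 1)) (P s) b < 0
  left_mouth : 0 ≤ orient a (P s) (P (s + 1)) ∧ 0 ≤ orient a (P s) (P (s + 1 + 1))
  right_mouth : orient b (P (s + 1 + 1 + 1)) (P (s + 1)) ≤ 0 ∧
    orient b (P (s + 1 + 1 + 1)) (P (s + 1 + 1)) ≤ 0

variable {s : Fin (m + 1)} {g : ℝ × ℝ}

theorem threeEdges_subset_boundary (P : Polygon (ℝ × ℝ) (m + 1)) (s : Fin (m + 1)) :
    P.threeEdges s ⊆ P.boundary ℝ := by
  rw [threeEdges_eq]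
  exact union_subset (union_subset (edge_subset_boundary _ _) (edge_subset_boundary _ _))
    (edge_subset_boundary _ _)

theorem base_subset_threeEdges : segment ℝ (P (s + 1)) (P (s + 1 + 1)) ⊆ P.threeEdges s := by
  rw [threeEdges_eq]; exact fun x hx => .inl (.inr hx)

theorem guards_threeEdges (h : LookInto P s a b)
    (hab : ∀ t ∈ segment ℝ (P (s + 1)) (P (s + 1 + 1)),
      orient a (P (s + 1 + 1 + 1)) t ≤ 0 ∨ 0 ≤ orient b (P s) t) :
    P.Guards {a, b} (P.threeEdges s) := by
  have hK {K : Set (ℝ × ℝ)} {k l} (hk : k ∈ K) (hl : l ∈ K) : segment ℝ k l ⊆ convexHull ℝ K :=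
    (convex_convexHull ℝ K).segment_subset (subset_convexHull ℝ K hk) (subset_convexHull ℝ K hl)
  have through {g t} (ht : t ∈ segment ℝ (P (s + 1)) (P (s + 1 + 1)))
      (hg : convexHull ℝ {g, P (s + 1 + 1 + 1), P s} ⊆ P.closedRegion)
      (hg₀ : orient (P (s + 1 + 1 + 1)) (P s) g < 0) (h₁ : orient g (P (s + 1 + 1 + 1)) t ≤ 0)
      (h₂ : 0 ≤ orient g (P s) t) : P.Sees g t := by
    rw [sees_comm]
    exact sees_through_segment h.nook_subset hg (convex_convexHull ℝ _) (convex_convexHull ℝ _)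
      (hK (by simp) (by simp) ht) (subset_convexHull ℝ _ (by simp)) (hK (by simp) (by simp))
      (hK (by simp) (by simp)) (orient_mem_of_mem_segment (convex_Ici 0) h.base_behind_mouth.1
        h.base_behind_mouth.2 ht) hg₀ (by rwa [← orient_rotate t]) (by rwa [← orient_rotate t])
  intro t ht
  rw [threeEdges_eq] at ht
  rcases ht with (ht | ht) | ht
  · exact ⟨a, by simp, sees_of_convexHull_subset h.first_subset (subset_convexHull ℝ _ (by simp))
      (hK (by simp) (by simp) ht)⟩
  · rcases hab t ht with hat | hbt
    · refine ⟨a, by simp, through ht h.left_subset h.left_front hat ?_⟩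
      exact orient_mem_of_mem_segment (convex_Ici 0) h.left_mouth.1 h.left_mouth.2 ht
    · refine ⟨b, by simp, through ht h.right_subset h.right_front ?_ hbt⟩
      exact orient_mem_of_mem_segment (convex_Iic 0) h.right_mouth.1 h.right_mouth.2 ht
  · exact ⟨b, by simp, sees_of_convexHull_subset h.last_subset (subset_convexHull ℝ _ (by simp))
      (hK (by simp) (by simp) ht)⟩

/-- The nook `s` is convex at its base, and its first and last walls and its base are visible only
from the inner side, because one can escape to infinity from their outer sides in the directions
`d 0`, `d 2` and `d 1`. The first and the last of these directions lead away from the base. -/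
structure IsOpaqueNook (P : Polygon (ℝ × ℝ) (m + 1)) (s : Fin (m + 1)) (d : Fin 3 → ℝ × ℝ) :
    Prop where
  turn_first : 0 < orient (P s) (P (s + 1)) (P (s + 1 + 1))
  turn_last : 0 < orient (P (s + 1)) (P (s + 1 + 1)) (P (s + 1 + 1 + 1))
  escape_first : IsEscape P s (d 0)
  escape_base : IsEscape P (s + 1) (d 1)
  escape_last : IsEscape P (s + 1 + 1) (d 2)
  tilt_first : 0 < orient (P (s + 1)) (P (s + 1) + d 0) (P (s + 1 + 1))
  tilt_last : orient (P (s + 1 + 1)) (P (s + 1 + 1) + d 2) (P (s + 1)) < 0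

/-- The last wall of the nook `s` hides a part of its base from `a`, and the first wall hides a part
of it from `b`. -/
structure HidesBase (P : Polygon (ℝ × ℝ) (m + 1)) (s : Fin (m + 1)) (a b : ℝ × ℝ) : Prop where
  left_hidden : orient (P (s + 1 + 1)) (P (s + 1 + 1 + 1)) a < 0
  right_hidden : orient (P s) (P (s + 1)) b < 0
  left_inside : 0 < orient (P (s + 1)) (P (s + 1 + 1)) a
  right_inside : 0 < orient (P (s + 1)) (P (s + 1 + 1)) b

theorem not_sees_hidden_by_last {d : Fin 3 → ℝ × ℝ} (hs : IsOpaqueNook P s d)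
    (h : HidesBase P s a b) (ht : t < 1)
    (ha : 0 < orient a (P (s + 1 + 1 + 1)) (lineMap (P (s + 1)) (P (s + 1 + 1)) t)) :
    ¬ P.Sees a (lineMap (P (s + 1)) (P (s + 1 + 1)) t) := by
  have ht' := sub_pos.2 ht
  rw [sees_comm]
  refine not_sees_of_crosses hs.escape_last ?_ h.left_hidden ?_ ?_
  · have := hs.turn_last
    rw [orient_lineMap, orient_self_left, mul_zero, add_zero, orient_rotate]
    positivity
  · have := mul_pos ht' h.left_inside
    rw [← orient_rotate, orient_lineMap, orient_self_right, mul_zero, add_zero, orient_swap,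
      orient_rotate]
    linarith
  · rwa [← orient_rotate]

theorem not_sees_hidden_by_first {d : Fin 3 → ℝ × ℝ} (hs : IsOpaqueNook P s d)
    (h : HidesBase P s a b) (ht : 0 < t)
    (hb : orient b (P s) (lineMap (P (s + 1)) (P (s + 1 + 1)) t) < 0) :
    ¬ P.Sees b (lineMap (P (s + 1)) (P (s + 1 + 1)) t) := by
  rw [sees_comm]
  refine not_sees_of_crosses hs.escape_first ?_ h.right_hidden ?_ ?_
  · have := hs.turn_first
    rw [orient_lineMap, orient_self_right, mul_zero, zero_add]
    positivity
  · rwa [← orient_rotate]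
  · have := h.right_inside
    rw [← orient_rotate, orient_lineMap, orient_self_right, mul_zero, zero_add, ← orient_rotate]
    positivity

/-- The two functions of the position on the base of the nook `s` that decide which part of it is
seen by the guards `a` and `b` are related by an identity in which only the number `e` has an
undetermined sign. As all terms are affine, the identity is required at the ends of the base only.
This is how a nook simulates the constraint `e ≤ 0`. -/
def NookIdentity (P : Polygon (ℝ × ℝ) (m + 1)) (s : Fin (m + 1)) (a b : ℝ × ℝ) (e : ℝ) : Prop :=
  ∃ l > 0, ∃ r > 0, ∃ k₁ > 0, ∃ k₂ > 0,
    l * orient a (P (s + 1 + 1 + 1)) (P (s + 1)) = r * orient b (P s) (P (s + 1)) + e * k₁ ∧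
    l * orient a (P (s + 1 + 1 + 1)) (P (s + 1 + 1)) =
      r * orient b (P s) (P (s + 1 + 1)) + e * k₂

variable {e : ℝ}

theorem NookIdentity.exists_eq (h : NookIdentity P s a b e) (ht₀ : 0 ≤ t) (ht₁ : t ≤ 1) :
    ∃ l > 0, ∃ r > 0, ∃ k > 0,
      l * orient a (P (s + 1 + 1 + 1)) (lineMap (P (s + 1)) (P (s + 1 + 1)) t) =
        r * orient b (P s) (lineMap (P (s + 1)) (P (s + 1 + 1)) t) + e * k := by
  obtain ⟨l, hl, r, hr, k₁, hk₁, k₂, hk₂, h₁, h₂⟩ := h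
  refine ⟨l, hl, r, hr, (1 - t) * k₁ + t * k₂,
    convex_Ioi (0 : ℝ) hk₁ hk₂ (sub_nonneg.2 ht₁) ht₀ (by ring), ?_⟩
  rw [orient_lineMap, orient_lineMap]
  linear_combination (1 - t) * h₁ + t * h₂

theorem exists_mem_Ioo_neg_pos {φ ψ : ℝ → ℝ} (hφ : Continuous φ) (hψ : Continuous ψ)
    (h₀ : φ 0 < 0) (h₁ : 0 < ψ 1) (h : ∀ t ∈ Ioo (0 : ℝ) 1, 0 ≤ φ t → 0 < ψ t) :
    ∃ t ∈ Ioo (0 : ℝ) 1, φ t < 0 ∧ 0 < ψ t := by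
  have hφ₀ : ∀ᶠ t in 𝓝[>] (0 : ℝ), φ t < 0 :=
    ((hφ.tendsto 0).mono_left nhdsWithin_le_nhds).eventually_lt_const h₀
  have hψ₁ : ∀ᶠ t in 𝓝[<] (1 : ℝ), 0 < ψ t :=
    ((hψ.tendsto 1).mono_left nhdsWithin_le_nhds).eventually_const_lt h₁
  refine isPreconnected_Ioo _ _ (isOpen_lt hφ continuous_const) (isOpen_lt continuous_const hψ)
    (fun t ht => (lt_or_ge (φ t) 0).imp_right (h t ht)) ?_ ?_
  · exact ((eventually_mem_set.2 (Ioo_mem_nhdsGT one_pos)).and hφ₀).exists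
  · exact ((eventually_mem_set.2 (Ioo_mem_nhdsLT one_pos)).and hψ₁).exists

theorem exists_hidden_of_pos (h : HidesBase P s a b) (hi : NookIdentity P s a b e) (he : 0 < e) :
    ∃ t ∈ Ioo (0 : ℝ) 1, orient b (P s) (lineMap (P (s + 1)) (P (s + 1 + 1)) t) < 0 ∧
      0 < orient a (P (s + 1 + 1 + 1)) (lineMap (P (s + 1)) (P (s + 1 + 1)) t) := by
  refine exists_mem_Ioo_neg_pos ((continuous_orient _ _).comp lineMap_continuous)
    ((continuous_orient _ _).comp lineMap_continuous) ?_ ?_ fun t ht hφ => ?_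
  · rw [lineMap_apply_zero, ← orient_rotate]; exact h.right_hidden
  · have := h.left_hidden
    rw [lineMap_apply_one, orient_swap, orient_rotate]; linarith
  · obtain ⟨l, hl, r, hr, k, hk, h⟩ := hi.exists_eq ht.1.le ht.2.le
    have : 0 < e * k := by positivity
    exact pos_of_mul_pos_right (h ▸ add_pos_of_nonneg_of_pos (mul_nonneg hr.le hφ) this) hl.le

theorem not_guards_of_pos {d : Fin 3 → ℝ × ℝ} (hs : IsOpaqueNook P s d) (h : HidesBase P s a b)
    (hi : NookIdentity P s a b e) (he : 0 < e)
    (hg : ∀ t ∈ openSegment ℝ (P (s + 1)) (P (s + 1 + 1)), ¬ P.Sees g t) :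
    ¬ P.Guards {a, b, g} (P.threeEdges s) := by
  intro hG
  obtain ⟨t, ht, hb, ha⟩ := exists_hidden_of_pos h hi he
  have ht' := lineMap_mem_openSegment (p := P (s + 1)) (q := P (s + 1 + 1)) ht
  obtain ⟨c, rfl | rfl | rfl, hc⟩ := hG _ <|
    base_subset_threeEdges (openSegment_subset_segment ℝ _ _ ht')
  · exact not_sees_hidden_by_last hs h ht.2 ha hc
  · exact not_sees_hidden_by_first hs h ht.1 hb hc
  · exact hg _ ht' hc

theorem guards_threeEdges_of_nonpos (h : LookInto P s a b) (hi : NookIdentity P s a b e)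
    (he : e ≤ 0) : P.Guards {a, b} (P.threeEdges s) := by
  refine guards_threeEdges h fun t ht => ?_
  rw [segment_eq_image_lineMap] at ht
  obtain ⟨t, ht, rfl⟩ := ht
  obtain ⟨l, hl, r, hr, k, hk, h⟩ := hi.exists_eq ht.1 ht.2
  by_contra! hn
  have h₁ := mul_pos hl hn.1
  have h₂ := mul_neg_of_pos_of_neg hr hn.2
  have h₃ := mul_nonpos_of_nonpos_of_nonneg he hk.le
  linarith

theorem nookImposes {d : Fin 3 → ℝ × ℝ} (hs : IsOpaqueNook P s d) (h : LookInto P s a b)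
    (h' : 0 < e → HidesBase P s a b) (hi : NookIdentity P s a b e)
    (hg : ∀ t ∈ openSegment ℝ (P (s + 1)) (P (s + 1 + 1)), ¬ P.Sees g t) :
    P.NookImposes s a b g (e ≤ 0) := by
  have hneg (hG : P.Guards {a, b, g} (P.threeEdges s)) : e ≤ 0 :=
    not_lt.1 fun he => not_guards_of_pos hs (h' he) hi he hg hG
  have mono (hG : P.Guards {a, b} (P.threeEdges s)) : P.Guards {a, b, g} (P.threeEdges s) :=
    fun t ht => (hG t ht).imp fun c hc => ⟨by rcases hc.1 with rfl | rfl <;> simp, hc.2⟩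
  have hpos := guards_threeEdges_of_nonpos h hi
  exact ⟨⟨fun hG => hneg (mono hG), hpos⟩, ⟨hneg, fun he => mono (hpos he)⟩⟩

theorem nookImposes_comm {C : Prop} : P.NookImposes s a b g C ↔ P.NookImposes s b a g C := by
  rw [Polygon.NookImposes, Polygon.NookImposes, pair_comm, insert_comm]

theorem not_sees_of_orient_neg (h : IsEscape P i d) (hg : g ∈ openSegment ℝ (P i) (P (i + 1)))
    (hp : orient (P i) (P (i + 1)) p < 0) : ¬ P.Sees g p :=
  not_sees_of_mem_openSegment h hg (left_mem_segment ℝ _ _) hp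

/-! ### The boundary points visible from a point on the base of a nook -/

/-- The point `q` on the base of the nook `s` sees the edge `k` through its mouth and no other part
of the boundary: `q` lies on the inner side of the edge `k`, this edge extends beyond both sides of
the cone of rays from `q` through the mouth, and neither the part of that cone in front of it nor
the two triangles between the cone and the base contain a further boundary point. -/
structure SightCone (P : Polygon (ℝ × ℝ) (m + 1)) (s k : Fin (m + 1)) (q : ℝ × ℝ) : Prop where
  mem_base : q ∈ openSegment ℝ (P (s + 1)) (P (s + 1 + 1))
  mouth : 0 < orient q (P (s + 1 + 1 + 1)) (P s)
  front : 0 < orient (P k) (P (k + 1)) q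
  right_of_cone : 0 < orient q (P k) (P (s + 1 + 1 + 1)) ∧ 0 < orient q (P k) (P s)
  left_of_cone : 0 < orient (P (k + 1)) q (P (s + 1 + 1 + 1)) ∧ 0 < orient (P (k + 1)) q (P s)
  boundary_first : triangle (P s) (P (s + 1)) q ∩ P.boundary ℝ ⊆ P.threeEdges s
  boundary_last : triangle q (P (s + 1 + 1)) (P (s + 1 + 1 + 1)) ∩ P.boundary ℝ ⊆ P.threeEdges s
  boundary_cone : triangle q (P k) (P (k + 1)) ∩ P.boundary ℝ ∩
    {g | 0 ≤ orient q (P (s + 1 + 1 + 1)) g ∧ 0 ≤ orient (P s) q g} ⊆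
    P.threeEdges s ∪ segment ℝ (P k) (P (k + 1))

variable {k : Fin (m + 1)} {D : Fin 3 → ℝ × ℝ}

theorem orient_nonneg_of_sees (h : IsEscape P i d) (hpg : P.Sees p g)
    (hp : 0 ≤ orient (P i) (P (i + 1)) p) (hi : 0 < orient p (P i) g)
    (hi' : 0 < orient (P (i + 1)) p g) : 0 ≤ orient (P i) (P (i + 1)) g := by
  by_contra! hg
  refine not_sees_of_crosses h hp hg ?_ ?_ hpg
  · rw [orient_swap, ← orient_rotate]; linarith
  · rwa [orient_rotate]

theorem orient_pos_of_mem_cone (hab : 0 < orient q a b) (ha : 0 ≤ orient q a p)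
    (hb : 0 ≤ orient b q p) (hp : p ≠ q) (hq : orient u v q = 0) (hua : 0 < orient u v a)
    (hub : 0 < orient u v b) : 0 < orient u v p := by
  have h := orient_mul_orient q a b p u v
  rw [hq, mul_zero, zero_add] at h
  have h₀ : 0 < orient b q p * orient u v a + orient q a p * orient u v b := by
    rcases ha.eq_or_lt' with ha₀ | ha
    · have := hb.lt_of_ne' fun hb₀ => hp (eq_of_orient_eq_zero hab.ne' ha₀ hb₀)
      positivity
    · positivity
  exact pos_of_mul_pos_right (h ▸ h₀) hab.le

theorem right_mem_segment_lineMap {t' : ℝ} (ht : t ≤ 1) (ht' : 1 ≤ t') :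
    b ∈ segment ℝ (lineMap a b t) (lineMap a b t' : ℝ × ℝ) := by
  rw [← image_segment, segment_eq_Icc (ht.trans ht')]
  exact ⟨1, ⟨ht, ht'⟩, lineMap_apply_one _ _⟩

theorem not_sees_beyond_last (h : IsOpaqueNook P s D) (hq : t ≤ 1) {t' : ℝ} (ht' : 1 < t') :
    ¬ P.Sees (lineMap (P (s + 1)) (P (s + 1 + 1)) t) (lineMap (P (s + 1)) (P (s + 1 + 1)) t') := by
  have h₁ := sub_neg.2 ht'
  have hturn := h.turn_last
  refine not_sees_of_enters_strip h.escape_last (right_mem_segment_lineMap hq ht'.le)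
    (.inr ⟨orient_self_right _ _, ?_⟩) (.inr ⟨orient_self_left _ _, ?_⟩) (.inl ?_)
  · rw [orient_lineMap, orient_self_right, mul_zero, add_zero, orient_swap, orient_rotate]
    exact mul_pos_of_neg_of_neg h₁ (neg_lt_zero.2 hturn)
  · rw [orient_lineMap, orient_self_left, mul_zero, add_zero]
    exact mul_pos_of_neg_of_neg h₁ h.tilt_last
  · have := h.escape_last.1
    convert this using 1
    simp only [orient, Prod.fst_add, Prod.snd_add]; ring

theorem not_sees_beyond_first (h : IsOpaqueNook P s D) (hq : 0 ≤ t) {t' : ℝ} (ht' : t' < 0) :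
    ¬ P.Sees (lineMap (P (s + 1)) (P (s + 1 + 1)) t) (lineMap (P (s + 1)) (P (s + 1 + 1)) t') := by
  have hturn := h.turn_first
  have hmem : P (s + 1) ∈ segment ℝ (lineMap (P (s + 1)) (P (s + 1 + 1)) t)
      (lineMap (P (s + 1)) (P (s + 1 + 1)) t') := by
    rw [← lineMap_apply_one_sub _ _ t, ← lineMap_apply_one_sub _ _ t']
    exact right_mem_segment_lineMap (by linarith) (by linarith)
  refine not_sees_of_enters_strip h.escape_first hmem
    (.inr ⟨orient_self_left _ _, ?_⟩) (.inl ?_) (.inr ⟨orient_self_right _ _, ?_⟩)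
  · rw [orient_lineMap, orient_self_left, mul_zero, zero_add, orient_swap]
    exact mul_pos_of_neg_of_neg ht' (neg_lt_zero.2 hturn)
  · rw [orient_rotate]; exact h.escape_first.1
  · rw [orient_lineMap, orient_self_right, mul_zero, zero_add, orient_swap]
    exact mul_pos_of_neg_of_neg ht' (neg_lt_zero.2 h.tilt_first)

theorem mem_base_or_orient_pos_of_sees (h : IsOpaqueNook P s D)
    (hq : q ∈ openSegment ℝ (P (s + 1)) (P (s + 1 + 1))) (hqg : P.Sees q g) :
    g ∈ segment ℝ (P (s + 1)) (P (s + 1 + 1)) ∨ 0 < orient (P (s + 1)) (P (s + 1 + 1)) g := by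
  rcases lt_trichotomy (orient (P (s + 1)) (P (s + 1 + 1)) g) 0 with hg | hg | hg
  · exact absurd hqg (not_sees_of_orient_neg h.escape_base hq hg)
  · left
    rw [openSegment_eq_image_lineMap] at hq
    obtain ⟨t, ht, rfl⟩ := hq
    rw [eq_lineMap_of_orient_eq_zero h.turn_last.ne' hg] at hqg ⊢
    refine lineMap_mem_segment ⟨?_, ?_⟩ <;> by_contra! hn
    · exact not_sees_beyond_first h ht.1.le hn hqg
    · exact not_sees_beyond_last h ht.2.le hn hqg
  · exact .inr hg

theorem SightCone.mem_threeEdges_of_orient_neg (h : IsOpaqueNook P s D) (hc : SightCone P s k q)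
    (hqg : P.Sees q g) (hgP : g ∈ P.boundary ℝ) (hg : 0 < orient (P (s + 1)) (P (s + 1 + 1)) g)
    (hneg : orient q (P (s + 1 + 1 + 1)) g < 0 ∨ orient (P s) q g < 0) : g ∈ P.threeEdges s := by
  obtain ⟨t, ⟨ht₀, ht₁⟩, rfl⟩ : ∃ t ∈ Ioo (0 : ℝ) 1, lineMap (P (s + 1)) (P (s + 1 + 1)) t = q := by
    simpa [openSegment_eq_image_lineMap] using hc.mem_base
  have ht₁' := sub_pos.2 ht₁
  have hturn := h.turn_first
  have hturn' := h.turn_last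
  rcases hneg with hneg | hneg
  · have hg₂ : 0 < orient (lineMap (P (s + 1)) (P (s + 1 + 1)) t) (P (s + 1 + 1)) g := by
      rw [← orient_rotate, orient_lineMap, orient_self_left, mul_zero, add_zero, orient_rotate]
      positivity
    have hg₃ : 0 < orient (P (s + 1 + 1 + 1)) (lineMap (P (s + 1)) (P (s + 1 + 1)) t) g := by
      rw [orient_swap]; linarith
    refine hc.boundary_last
      ⟨⟨hg₂.le, orient_nonneg_of_sees h.escape_last hqg ?_ hg₂ hg₃, hg₃.le⟩, hgP⟩
    rw [orient_lineMap, orient_self_left, mul_zero, add_zero, orient_rotate]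
    positivity
  · have hg₁ : 0 < orient (P (s + 1)) (lineMap (P (s + 1)) (P (s + 1 + 1)) t) g := by
      rw [← orient_rotate, ← orient_rotate, orient_lineMap, orient_self_right, mul_zero, zero_add,
        ← orient_rotate]
      positivity
    have hg₀ : 0 < orient (lineMap (P (s + 1)) (P (s + 1 + 1)) t) (P s) g := by
      rw [orient_swap]; linarith
    refine hc.boundary_first
      ⟨⟨orient_nonneg_of_sees h.escape_first hqg ?_ hg₀ hg₁, hg₁.le, hg₀.le⟩, hgP⟩
    rw [orient_lineMap, orient_self_right, mul_zero, zero_add]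
    positivity

theorem SightCone.mem_threeEdges_or_mem_openSegment {D' : ℝ × ℝ} (h : IsOpaqueNook P s D)
    (hk : IsEscape P k D') (hc : SightCone P s k q) (hqg : P.Sees q g) (hgP : g ∈ P.boundary ℝ) :
    g ∈ P.threeEdges s ∨ g ∈ openSegment ℝ (P k) (P (k + 1)) := by
  obtain hg | hg := mem_base_or_orient_pos_of_sees h hc.mem_base hqg
  · exact .inl (base_subset_threeEdges hg)
  by_cases hneg : orient q (P (s + 1 + 1 + 1)) g < 0 ∨ orient (P s) q g < 0
  · exact .inl (hc.mem_threeEdges_of_orient_neg h hqg hgP hg hneg)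
  push Not at hneg
  have hgq : g ≠ q := by
    rintro rfl
    exact hg.ne' (orient_eq_zero_of_mem_segment (openSegment_subset_segment ℝ _ _ hc.mem_base))
  have hright : 0 < orient q (P k) g := orient_pos_of_mem_cone hc.mouth hneg.1 hneg.2 hgq
    (orient_self_left _ _) hc.right_of_cone.1 hc.right_of_cone.2
  have hleft : 0 < orient (P (k + 1)) q g := orient_pos_of_mem_cone hc.mouth hneg.1 hneg.2 hgq
    (orient_self_right _ _) hc.left_of_cone.1 hc.left_of_cone.2
  have hfront := orient_nonneg_of_sees hk hqg hc.front.le hright hleft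
  refine (hc.boundary_cone ⟨⟨⟨hright.le, hfront, hleft.le⟩, hgP⟩, hneg⟩).imp_right fun hgk =>
    mem_openSegment_of_ne_left_right ?_ ?_ hgk
  · rintro rfl; simp at hright
  · rintro rfl; simp at hleft

theorem SightCone.inter_nonempty {D' : ℝ × ℝ} {G : Set (ℝ × ℝ)} (hc : SightCone P s k q)
    (h : IsOpaqueNook P s D) (hk : IsEscape P k D') (hG : P.IsBoundaryGuarding G) :
    (G ∩ P.threeEdges s).Nonempty ∨ (G ∩ openSegment ℝ (P k) (P (k + 1))).Nonempty := by
  obtain ⟨g, hg, hgq⟩ := hG.2 q <| edge_subset_boundary _ _ <|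
    openSegment_subset_segment ℝ _ _ hc.mem_base
  exact (hc.mem_threeEdges_or_mem_openSegment h hk (sees_comm.1 hgq) (hG.1 hg)).imp
    (fun h => ⟨g, hg, h⟩) (fun h => ⟨g, hg, h⟩)

/-! ### Integer points -/

/-- The point of the real plane with the given integer coordinates. -/
def pt (a : ℤ × ℤ) : ℝ × ℝ := (a.1, a.2)

theorem pt_injective : Function.Injective pt := fun a b h => by
  simpa [pt, Prod.ext_iff] using h

theorem pt_add (a b : ℤ × ℤ) : pt (a + b) = pt a + pt b := by
  simp [pt]

theorem orient_pt (a b c : ℤ × ℤ) : orient (pt a) (pt b) (pt c) = (orient a b c : ℤ) := by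
  simp [orient, pt]

section PosNeg

variable {a b c u v : ℤ × ℤ}

@[simp]
theorem orient_pt_pos : 0 < orient (pt a) (pt b) (pt c) ↔ 0 < orient a b c := by
  rw [orient_pt, Int.cast_pos]

@[simp]
theorem orient_pt_nonneg : 0 ≤ orient (pt a) (pt b) (pt c) ↔ 0 ≤ orient a b c := by
  rw [orient_pt, Int.cast_nonneg_iff]

@[simp]
theorem orient_pt_neg : orient (pt a) (pt b) (pt c) < 0 ↔ orient a b c < 0 := by
  rw [orient_pt, Int.cast_lt_zero]

@[simp]
theorem orient_pt_nonpos : orient (pt a) (pt b) (pt c) ≤ 0 ↔ orient a b c ≤ 0 := by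
  rw [orient_pt, Int.cast_nonpos]

theorem orient_pos_of_mem_segment (ha : 0 < orient u v a) (hb : 0 < orient u v b)
    (hx : x ∈ segment ℝ (pt a) (pt b)) : 0 < orient (pt u) (pt v) x :=
  orient_mem_of_mem_segment (convex_Ioi 0) (orient_pt_pos.2 ha) (orient_pt_pos.2 hb) hx

theorem orient_nonneg_of_mem_segment (ha : 0 ≤ orient u v a) (hb : 0 ≤ orient u v b)
    (hx : x ∈ segment ℝ (pt a) (pt b)) : 0 ≤ orient (pt u) (pt v) x :=
  orient_mem_of_mem_segment (convex_Ici 0) (orient_pt_nonneg.2 ha) (orient_pt_nonneg.2 hb) hx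

theorem orient_neg_of_mem_segment (ha : orient u v a < 0) (hb : orient u v b < 0)
    (hx : x ∈ segment ℝ (pt a) (pt b)) : orient (pt u) (pt v) x < 0 :=
  orient_mem_of_mem_segment (convex_Iio 0) (orient_pt_neg.2 ha) (orient_pt_neg.2 hb) hx

theorem orient_nonpos_of_mem_segment (ha : orient u v a ≤ 0) (hb : orient u v b ≤ 0)
    (hx : x ∈ segment ℝ (pt a) (pt b)) : orient (pt u) (pt v) x ≤ 0 :=
  orient_mem_of_mem_segment (convex_Iic 0) (orient_pt_nonpos.2 ha) (orient_pt_nonpos.2 hb) hx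

end PosNeg

/-- The polygon with the given integer vertices. -/
def intPolygon (V : Fin (m + 1) → ℤ × ℤ) : Polygon (ℝ × ℝ) (m + 1) := ⟨fun i => pt (V i)⟩

variable {V : Fin (m + 1) → ℤ × ℤ}

@[simp]
theorem intPolygon_apply (i : Fin (m + 1)) : intPolygon V i = pt (V i) := rfl

theorem hasIntegerVertices_intPolygon : (intPolygon V).HasIntegerVertices :=
  fun i => ⟨(V i).1, (V i).2, rfl⟩

/-! ### Simple polygons -/

/-- A line through one of the two edges separates them. -/
def EdgesApart (V : Fin (m + 1) → ℤ × ℤ) (i j : Fin (m + 1)) : Prop :=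
  ∃ f ∈ [(V i, V (i + 1)), (V (i + 1), V i), (V j, V (j + 1)), (V (j + 1), V j)],
    0 ≤ orient f.1 f.2 (V i) ∧ 0 ≤ orient f.1 f.2 (V (i + 1)) ∧
    orient f.1 f.2 (V j) ≤ 0 ∧ orient f.1 f.2 (V (j + 1)) ≤ 0 ∧
    (0 < orient f.1 f.2 (V i) ∧ 0 < orient f.1 f.2 (V (i + 1)) ∨
      orient f.1 f.2 (V j) < 0 ∧ orient f.1 f.2 (V (j + 1)) < 0)

instance (i j : Fin (m + 1)) : Decidable (EdgesApart V i j) := by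
  unfold EdgesApart; infer_instance

theorem EdgesApart.disjoint {i j : Fin (m + 1)} (h : EdgesApart V i j) :
    Disjoint (segment ℝ (pt (V i)) (pt (V (i + 1)))) (segment ℝ (pt (V j)) (pt (V (j + 1)))) := by
  obtain ⟨f, -, h₁, h₂, h₃, h₄, h⟩ := h
  refine disjoint_left.2 fun x hi hj => ?_
  rcases h with ⟨h₁, h₂⟩ | ⟨h₃, h₄⟩
  · exact (orient_nonpos_of_mem_segment h₃ h₄ hj).not_gt (orient_pos_of_mem_segment h₁ h₂ hi)
  · exact (orient_nonneg_of_mem_segment h₁ h₂ hi).not_gt (orient_neg_of_mem_segment h₃ h₄ hj)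

theorem disjoint_threeEdges {s t : Fin (m + 1)}
    (h : ∀ i ∈ [s, s + 1, s + 1 + 1], ∀ j ∈ [t, t + 1, t + 1 + 1], EdgesApart V i j) :
    Disjoint ((intPolygon V).threeEdges s) ((intPolygon V).threeEdges t) := by
  simp only [List.mem_cons, List.not_mem_nil, or_false, forall_eq_or_imp, forall_eq] at h
  obtain ⟨⟨h₀₀, h₀₁, h₀₂⟩, ⟨h₁₀, h₁₁, h₁₂⟩, h₂₀, h₂₁, h₂₂⟩ := h
  simp only [threeEdges_eq, disjoint_union_left, disjoint_union_right]
  exact ⟨⟨⟨⟨h₀₀.disjoint, h₁₀.disjoint⟩, h₂₀.disjoint⟩, ⟨h₀₁.disjoint, h₁₁.disjoint⟩,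
    h₂₁.disjoint⟩, ⟨h₀₂.disjoint, h₁₂.disjoint⟩, h₂₂.disjoint⟩

theorem eq_of_mem_segment_of_mem_segment (h : orient a b c ≠ 0) (h₁ : x ∈ segment ℝ a b)
    (h₂ : x ∈ segment ℝ b c) : x = b := by
  rw [← orient_rotate] at h
  exact eq_of_orient_eq_zero h (orient_eq_zero_of_mem_segment h₂)
    (orient_eq_zero_of_mem_segment h₁)

theorem isSimplePlane_intPolygon (hm : 2 ≤ m) (hV : Function.Injective V)
    (hturn : ∀ i, orient (V i) (V (i + 1)) (V (i + 1 + 1)) < 0 ∨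
      0 < orient (V i) (V (i + 1)) (V (i + 1 + 1)))
    (hapart : ∀ i j, i ≠ j → j ≠ i + 1 → i ≠ j + 1 → EdgesApart V i j) :
    (intPolygon V).IsSimplePlane := by
  have adjacent (i : Fin (m + 1)) {x : ℝ × ℝ} (hi : x ∈ segment ℝ (pt (V i)) (pt (V (i + 1))))
      (hj : x ∈ segment ℝ (pt (V (i + 1))) (pt (V (i + 1 + 1)))) : x = pt (V (i + 1)) :=
    eq_of_mem_segment_of_mem_segment
      (by rw [orient_pt]; exact_mod_cast (hturn i).elim ne_of_lt ne_of_gt) hi hj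
  refine ⟨by lia, pt_injective.comp hV, fun i j hij x ⟨hi, hj⟩ => ?_⟩
  rw [edgeSet_eq_segment] at hi hj
  simp only [intPolygon_apply, finRotate_apply, mem_inter_iff, mem_insert_iff,
    mem_singleton_iff] at hi hj ⊢
  by_cases hji : j = i + 1
  · subst hji; simp [adjacent i hi hj]
  by_cases hij' : i = j + 1
  · subst hij'; simp [adjacent j hj hi]
  · exact absurd hj (disjoint_left.1 (hapart i j hij hji hij').disjoint hi)

/-! ### Certificates in integer arithmetic -/

/-- A certificate for `IsTriangulation`: the triangles have the vertices `L j 0`, `L j 1`, `L j 2`,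
in this cyclic order. -/
def TriangulationCert {r : ℕ} (V : Fin (m + 1) → ℤ × ℤ) (L : Fin r → Fin 3 → Fin (m + 1)) : Prop :=
  ∀ j, 0 < orient (V (L j 0)) (V (L j 1)) (V (L j 2)) ∧
    ∀ k, L j (k + 1) = L j k + 1 ∨ ∃ j' k', L j' k' = L j (k + 1) ∧ L j' (k' + 1) = L j k

section Triangulation

variable {r : ℕ} {L : Fin r → Fin 3 → Fin (m + 1)}

instance : Decidable (TriangulationCert V L) := by
  unfold TriangulationCert; infer_instance

/-- The triangles of a list, each in its three cyclic orders. -/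
def rotations (L : Fin r → Fin 3 → Fin (m + 1)) :
    Set (Fin (m + 1) × Fin (m + 1) × Fin (m + 1)) :=
  {t | ∃ j k, t = (L j k, L j (k + 1), L j (k + 2))}

theorem TriangulationCert.isTriangulation (h : TriangulationCert V L) :
    IsTriangulation (intPolygon V) (rotations L) := by
  rintro a b c ⟨j, k, hjk⟩
  obtain ⟨rfl, rfl, rfl⟩ := by simpa only [Prod.mk.injEq] using hjk
  obtain ⟨hpos, hside⟩ := h j
  refine ⟨⟨j, k + 1, by simp [add_assoc]⟩, ?_, (hside k).imp_right ?_⟩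
  · simp only [intPolygon_apply, orient_pt_pos]
    fin_cases k
    exacts [hpos, hpos.trans_eq (orient_rotate _ _ _).symm, hpos.trans_eq (orient_rotate _ _ _)]
  · rintro ⟨j', k', h₁, h₂⟩
    exact ⟨_, j', k', by rw [h₁, h₂]⟩

end Triangulation

theorem orient_pos_of_mem_strip (hd : 0 < orient b a (a + d)) (ha : 0 ≤ orient u v a)
    (hb : 0 ≤ orient u v b) (had : orient u v a ≤ orient u v (a + d))
    (h : 0 < orient u v a ∨ 0 < orient u v b ∨ orient u v a < orient u v (a + d))
    (hp : p ∈ strip a b d) : 0 < orient u v p := by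
  obtain ⟨h₁, h₂, h₃⟩ := hp
  have key : orient b a (a + d) * orient u v p = orient (b + d) b p * orient u v a +
      orient a (a + d) p * orient u v b + orient b a p * (orient u v (a + d) - orient u v a) := by
    simp only [orient, Prod.fst_add, Prod.snd_add]; ring
  have had' := sub_nonneg.2 had
  refine pos_of_mul_pos_right (key ▸ ?_) hd.le
  rcases h with h | h | h
  · positivity
  · positivity
  · have := sub_pos.2 h
    positivity

/-- A certificate for `IsEscape`: each edge of the polygon is separated from the strip by the line
through one of the sides of the strip or through the edge. -/
def EscapeCert (V : Fin (m + 1) → ℤ × ℤ) (i : Fin (m + 1)) (d : ℤ × ℤ) : Prop :=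
  0 < orient (V (i + 1)) (V i) (V i + d) ∧
  ∀ j, ∃ f ∈ [(V (i + 1), V i), (V i, V i + d), (V (i + 1) + d, V (i + 1)), (V j, V (j + 1)),
      (V (j + 1), V j)],
    orient f.1 f.2 (V j) ≤ 0 ∧ orient f.1 f.2 (V (j + 1)) ≤ 0 ∧
    0 ≤ orient f.1 f.2 (V i) ∧ 0 ≤ orient f.1 f.2 (V (i + 1)) ∧
    orient f.1 f.2 (V i) ≤ orient f.1 f.2 (V i + d) ∧
    (0 < orient f.1 f.2 (V i) ∨ 0 < orient f.1 f.2 (V (i + 1)) ∨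
      orient f.1 f.2 (V i) < orient f.1 f.2 (V i + d))

instance (i : Fin (m + 1)) (d : ℤ × ℤ) : Decidable (EscapeCert V i d) := by
  unfold EscapeCert; infer_instance

theorem EscapeCert.isEscape {d : ℤ × ℤ} (h : EscapeCert V i d) :
    IsEscape (intPolygon V) i (pt d) := by
  obtain ⟨hd, hj⟩ := h
  simp only [IsEscape, intPolygon_apply, ← pt_add, orient_pt_pos]
  refine ⟨hd, disjoint_left.2 fun x hx hxP => ?_⟩
  obtain ⟨j, hxj⟩ := mem_boundary_iff.1 hxP
  obtain ⟨f, -, hj, hj', ha, hb, had, h⟩ := hj j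
  refine (orient_nonpos_of_mem_segment hj hj' hxj).not_gt
    (orient_pos_of_mem_strip ?_ ?_ ?_ ?_ ?_ hx)
  all_goals simpa only [← pt_add, orient_pt, Int.cast_pos, Int.cast_nonneg_iff, Int.cast_le,
    Int.cast_lt]

/-- A certificate for `IsOpaqueNook`. -/
def OpaqueNookCert (V : Fin (m + 1) → ℤ × ℤ) (s : Fin (m + 1)) (d : Fin 3 → ℤ × ℤ) : Prop :=
  0 < orient (V s) (V (s + 1)) (V (s + 1 + 1)) ∧
  0 < orient (V (s + 1)) (V (s + 1 + 1)) (V (s + 1 + 1 + 1)) ∧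
  EscapeCert V s (d 0) ∧ EscapeCert V (s + 1) (d 1) ∧ EscapeCert V (s + 1 + 1) (d 2) ∧
  0 < orient (V (s + 1)) (V (s + 1) + d 0) (V (s + 1 + 1)) ∧
  orient (V (s + 1 + 1)) (V (s + 1 + 1) + d 2) (V (s + 1)) < 0

instance (s : Fin (m + 1)) (d : Fin 3 → ℤ × ℤ) : Decidable (OpaqueNookCert V s d) := by
  unfold OpaqueNookCert; infer_instance

theorem OpaqueNookCert.isOpaqueNook {d : Fin 3 → ℤ × ℤ} (h : OpaqueNookCert V s d) :
    IsOpaqueNook (intPolygon V) s (pt ∘ d) := by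
  obtain ⟨h₁, h₂, h₃, h₄, h₅, h₆, h₇⟩ := h
  refine ⟨orient_pt_pos.2 h₁, orient_pt_pos.2 h₂, h₃.isEscape, h₄.isEscape, h₅.isEscape, ?_, ?_⟩
  · simpa only [Function.comp_apply, intPolygon_apply, ← pt_add, orient_pt_pos]
  · simpa only [Function.comp_apply, intPolygon_apply, ← pt_add, orient_pt_neg]

/-- A certificate for `SeparatedFrom`: the line through `u` and `v` separates the segment from `a`
to `b` from the relative interior of the convex hull of the points `K i`. -/
def Separates {ι : Type*} (K : ι → ℤ × ℤ) (a b u v : ℤ × ℤ) : Prop :=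
  orient u v a ≤ 0 ∧ orient u v b ≤ 0 ∧ (∀ i, 0 ≤ orient u v (K i)) ∧
    ((∃ i, 0 < orient u v (K i)) ∨ orient u v a < 0 ∧ orient u v b < 0)

/-- No edge of the polygon meets the relative interior of the convex hull of the points `K i`:
a line through the edge or through two of these points separates them. -/
def InteriorFree {ι : Type*} (V : Fin (m + 1) → ℤ × ℤ) (K : ι → ℤ × ℤ) : Prop :=
  ∀ i, (Separates K (V i) (V (i + 1)) (V i) (V (i + 1)) ∨
    Separates K (V i) (V (i + 1)) (V (i + 1)) (V i)) ∨
    ∃ k l, Separates K (V i) (V (i + 1)) (K k) (K l)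

/-- A certificate for the inclusion of the convex hull of the points `K i` in the polygon: no edge
meets its relative interior, and its center lies in a triangle of the triangulation `L`. -/
def HullCert {ι : Type*} [Fintype ι] {r : ℕ} (V : Fin (m + 1) → ℤ × ℤ)
    (L : Fin r → Fin 3 → Fin (m + 1)) (K : ι → ℤ × ℤ) : Prop :=
  InteriorFree V K ∧ ∃ j, ∀ k, 0 ≤ ∑ i, orient (V (L j k)) (V (L j (k + 1))) (K i)

section Hull

variable {ι : Type*} {K : ι → ℤ × ℤ} {r : ℕ} {L : Fin r → Fin 3 → Fin (m + 1)}

instance [Fintype ι] (a b u v : ℤ × ℤ) : Decidable (Separates K a b u v) := by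
  unfold Separates; infer_instance

instance [Fintype ι] : Decidable (InteriorFree V K) := by
  unfold InteriorFree; infer_instance

instance [Fintype ι] : Decidable (HullCert V L K) := by
  unfold HullCert; infer_instance

theorem Separates.separatedFrom {a b u v : ℤ × ℤ} (h : Separates K a b u v) :
    SeparatedFrom (range (pt ∘ K)) (pt a) (pt b) :=
  ⟨pt u, pt v, by simpa [Separates] using h⟩

theorem InteriorFree.separatedFrom (h : InteriorFree V K) (i : Fin (m + 1)) :
    SeparatedFrom (range (pt ∘ K)) (intPolygon V i) (intPolygon V (i + 1)) := by
  obtain (h | h) | ⟨k, l, h⟩ := h i <;> exact h.separatedFrom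

theorem HullCert.convexHull_subset [Fintype ι] [Nonempty ι] (hL : TriangulationCert V L)
    (h : HullCert V L K) : convexHull ℝ (range (pt ∘ K)) ⊆ (intPolygon V).closedRegion := by
  obtain ⟨hfree, j, hj⟩ := h
  have hc {a b : ℤ × ℤ} (h : 0 ≤ ∑ i, orient a b (K i)) :
      0 ≤ orient (pt a) (pt b) (Finset.univ.centroid ℝ (pt ∘ K)) := by
    refine nonneg_of_mul_nonneg_right ((Int.cast_nonneg h).trans_eq ?_)
      (Nat.cast_pos.2 (Fintype.card_pos (α := ι)))
    simp only [card_mul_orient_centroid, Function.comp_apply, orient_pt, Int.cast_sum]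
  exact convexHull_subset_closedRegion hL.isTriangulation (isRelInner_centroid _)
    (centroid_mem_convexHull_range _) (mem_biUnion ⟨j, 0, rfl⟩ ⟨hc (hj 0), hc (hj 1), hc (hj 2)⟩)
    hfree.separatedFrom

end Hull

/-- A certificate for `LookInto` that does not depend on the positions of the two guards on the
segment from `A 0` to `A 1` and on the segment from `B 0` to `B 1`. -/
def LookIntoCert {r : ℕ} (V : Fin (m + 1) → ℤ × ℤ) (L : Fin r → Fin 3 → Fin (m + 1))
    (s : Fin (m + 1)) (A B : Fin 2 → ℤ × ℤ) : Prop :=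
  HullCert V L ![V s, V (s + 1), V (s + 1 + 1), V (s + 1 + 1 + 1)] ∧
  HullCert V L ![A 0, A 1, V (s + 1 + 1 + 1), V s] ∧
  HullCert V L ![B 0, B 1, V (s + 1 + 1 + 1), V s] ∧
  HullCert V L ![A 0, A 1, V s, V (s + 1)] ∧
  HullCert V L ![B 0, B 1, V (s + 1 + 1), V (s + 1 + 1 + 1)] ∧
  0 ≤ orient (V (s + 1 + 1 + 1)) (V s) (V (s + 1)) ∧
  0 ≤ orient (V (s + 1 + 1 + 1)) (V s) (V (s + 1 + 1)) ∧
  ∀ i, orient (V (s + 1 + 1 + 1)) (V s) (A i) < 0 ∧ orient (V (s + 1 + 1 + 1)) (V s) (B i) < 0 ∧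
    0 ≤ orient (V s) (V (s + 1)) (A i) ∧ 0 ≤ orient (V s) (V (s + 1 + 1)) (A i) ∧
    orient (V (s + 1 + 1 + 1)) (V (s + 1)) (B i) ≤ 0 ∧
    orient (V (s + 1 + 1 + 1)) (V (s + 1 + 1)) (B i) ≤ 0

/-- A certificate for `HidesBase` that does not depend on the positions of the two guards on the
segment from `A 0` to `A 1` and on the segment from `B 0` to `B 1`, but requires a constraint
simulated by the nook to be violated: then the end of the base cannot be visible from both sides,
and it suffices that it is visible from one of them. -/
def HidesBaseCert (V : Fin (m + 1) → ℤ × ℤ) (s : Fin (m + 1)) (A B : Fin 2 → ℤ × ℤ) : Prop :=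
  ((∀ i, orient (V (s + 1 + 1)) (V (s + 1 + 1 + 1)) (A i) < 0) ∨
    ∀ i, 0 ≤ orient (V s) (V (s + 1 + 1)) (B i)) ∧
  ∀ i, orient (V s) (V (s + 1)) (B i) < 0 ∧ 0 < orient (V (s + 1)) (V (s + 1 + 1)) (A i) ∧
    0 < orient (V (s + 1)) (V (s + 1 + 1)) (B i)

section Look

variable {r : ℕ} {L : Fin r → Fin 3 → Fin (m + 1)} {A B : Fin 2 → ℤ × ℤ}

instance : Decidable (LookIntoCert V L s A B) := by
  unfold LookIntoCert; infer_instance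

instance : Decidable (HidesBaseCert V s A B) := by
  unfold HidesBaseCert; infer_instance

theorem range_pt_comp_vecCons {n : ℕ} (u : ℤ × ℤ) (K : Fin n → ℤ × ℤ) :
    range (pt ∘ Matrix.vecCons u K) = insert (pt u) (range (pt ∘ K)) := by
  rw [range_comp, Matrix.range_cons, image_union, image_singleton, singleton_union, range_comp]

theorem HullCert.isNook (hL : TriangulationCert V L)
    (h : HullCert V L ![V s, V (s + 1 + 1 + 1)]) :
    (intPolygon V).IsNook s := by
  have hK : range (pt ∘ ![V s, V (s + 1 + 1 + 1)]) =
      {intPolygon V s, intPolygon V (s + 1 + 1 + 1)} := by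
    simp [range_pt_comp_vecCons]
  exact isNook_of_convexHull_subset (hK ▸ h.convexHull_subset hL) (hK ▸ h.1.separatedFrom)

theorem HullCert.convexHull_insert_subset {u v : ℤ × ℤ} (hL : TriangulationCert V L)
    (h : HullCert V L ![A 0, A 1, u, v]) (ha : a ∈ segment ℝ (pt (A 0)) (pt (A 1))) :
    convexHull ℝ {a, pt u, pt v} ⊆ (intPolygon V).closedRegion := by
  have hK : range (pt ∘ ![A 0, A 1, u, v]) = {pt (A 0), pt (A 1), pt u, pt v} := by
    simp [range_pt_comp_vecCons]
  refine subset_trans (convexHull_min ?_ (convex_convexHull ℝ _)) (h.convexHull_subset hL)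
  rw [hK, insert_subset_iff]
  refine ⟨segment_subset_convexHull (by simp) (by simp) ha, ?_⟩
  refine (insert_subset ?_ (singleton_subset_iff.2 ?_)).trans (subset_convexHull ℝ _) <;> simp

theorem LookIntoCert.lookInto (hL : TriangulationCert V L) (h : LookIntoCert V L s A B)
    (ha : a ∈ segment ℝ (pt (A 0)) (pt (A 1))) (hb : b ∈ segment ℝ (pt (B 0)) (pt (B 1))) :
    LookInto (intPolygon V) s a b := by
  obtain ⟨hnook, hA, hB, hfirst, hlast, h₁, h₂, hAB⟩ := h
  obtain ⟨⟨hA₀, hB₀, hA₁, hA₂, hB₁, hB₂⟩, ⟨hA₀', hB₀', hA₁', hA₂', hB₁', hB₂'⟩⟩ :=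
    Fin.forall_fin_two.1 hAB
  refine ⟨?_, hA.convexHull_insert_subset hL ha, hB.convexHull_insert_subset hL hb,
    hfirst.convexHull_insert_subset hL ha, hlast.convexHull_insert_subset hL hb,
    ⟨orient_pt_nonneg.2 h₁, orient_pt_nonneg.2 h₂⟩, orient_neg_of_mem_segment hA₀ hA₀' ha,
    orient_neg_of_mem_segment hB₀ hB₀' hb, ⟨?_, ?_⟩, ⟨?_, ?_⟩⟩
  · simpa [range_pt_comp_vecCons] using hnook.convexHull_subset hL
  · rw [← orient_rotate]; exact orient_nonneg_of_mem_segment hA₁ hA₁' ha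
  · rw [← orient_rotate]; exact orient_nonneg_of_mem_segment hA₂ hA₂' ha
  · rw [← orient_rotate]; exact orient_nonpos_of_mem_segment hB₁ hB₁' hb
  · rw [← orient_rotate]; exact orient_nonpos_of_mem_segment hB₂ hB₂' hb

theorem HidesBaseCert.hidesBase (h : HidesBaseCert V s A B)
    (hi : NookIdentity (intPolygon V) s a b e) (he : 0 < e)
    (ha : a ∈ segment ℝ (pt (A 0)) (pt (A 1))) (hb : b ∈ segment ℝ (pt (B 0)) (pt (B 1))) :
    HidesBase (intPolygon V) s a b := by
  obtain ⟨hleft, h⟩ := h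
  obtain ⟨⟨h₁, h₂, h₃⟩, ⟨h₁', h₂', h₃'⟩⟩ := Fin.forall_fin_two.1 h
  refine ⟨?_, orient_neg_of_mem_segment h₁ h₁' hb, orient_pos_of_mem_segment h₂ h₂' ha,
    orient_pos_of_mem_segment h₃ h₃' hb⟩
  rcases hleft with hleft | hright
  · exact orient_neg_of_mem_segment (hleft 0) (hleft 1) ha
  · obtain ⟨l, hl, r, hr, -, -, k, hk, -, hi⟩ := hi
    have hb₀ : 0 ≤ orient b (intPolygon V s) (intPolygon V (s + 1 + 1)) := by
      rw [← orient_rotate]; exact orient_nonneg_of_mem_segment (hright 0) (hright 1) hb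
    have hpos := hi.symm ▸ add_pos_of_nonneg_of_pos (mul_nonneg hr.le hb₀) (mul_pos he hk)
    rw [← orient_rotate, orient_swap]
    exact neg_lt_zero.2 (pos_of_mul_pos_right hpos hl.le)

end Look

/-- A certificate for the statement that of the points in the convex hull of `vs` that lie on the
left of all lines `hs`, only those in `rim` can lie on the segment from `a` to `b`. -/
def MeetsOnlyAt (hs : List ((ℤ × ℤ) × (ℤ × ℤ))) (vs rim : List (ℤ × ℤ)) (a b : ℤ × ℤ) : Prop :=
  (∃ f ∈ hs, orient f.1 f.2 a ≤ 0 ∧ orient f.1 f.2 b ≤ 0 ∧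
    (orient f.1 f.2 a < 0 ∧ (orient f.1 f.2 b < 0 ∨ b ∈ rim) ∨ orient f.1 f.2 b < 0 ∧ a ∈ rim)) ∨
  ∃ f ∈ [(a, b), (b, a)], ∀ v ∈ vs, 0 < orient f.1 f.2 v

instance (hs vs rim) (a b : ℤ × ℤ) : Decidable (MeetsOnlyAt hs vs rim a b) := by
  unfold MeetsOnlyAt; infer_instance

theorem eq_right_of_orient_nonneg (ha : orient u v a < 0) (hb : orient u v b ≤ 0)
    (hx : x ∈ segment ℝ a b) (h : 0 ≤ orient u v x) : x = b := by
  rw [segment_eq_image_lineMap] at hx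
  obtain ⟨t, ⟨ht₀, ht₁⟩, rfl⟩ := hx
  rw [orient_lineMap] at h
  obtain rfl : t = 1 := by nlinarith
  exact lineMap_apply_one _ _

theorem MeetsOnlyAt.mem_rim {hs vs rim} {a b : ℤ × ℤ} (h : MeetsOnlyAt hs vs rim a b)
    (hp : p ∈ convexHull ℝ (pt '' {v | v ∈ vs}))
    (hhs : ∀ f ∈ hs, 0 ≤ orient (pt f.1) (pt f.2) p) (hab : p ∈ segment ℝ (pt a) (pt b)) :
    ∃ r ∈ rim, pt r = p := by
  obtain ⟨f, hf, ha, hb, h⟩ | ⟨f, hf, hv⟩ := h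
  · rcases h with ⟨ha, hb | hb'⟩ | ⟨hb, ha'⟩
    · exact absurd (hhs f hf) (orient_neg_of_mem_segment ha hb hab).not_ge
    · exact ⟨b, hb', (eq_right_of_orient_nonneg (orient_pt_neg.2 ha) (orient_pt_nonpos.2 hb) hab
        (hhs f hf)).symm⟩
    · rw [segment_symm] at hab
      exact ⟨a, ha', (eq_right_of_orient_nonneg (orient_pt_neg.2 hb) (orient_pt_nonpos.2 ha) hab
        (hhs f hf)).symm⟩
  · have hpos : 0 < orient (pt f.1) (pt f.2) p := by
      refine orient_mem_of_mem_convexHull (convex_Ioi 0) ?_ hp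
      rintro _ ⟨v, hv', rfl⟩
      exact orient_pt_pos.2 (hv v hv')
    have h₀ := orient_eq_zero_of_mem_segment hab
    simp only [List.mem_cons, List.not_mem_nil, or_false] at hf
    rcases hf with rfl | rfl
    · exact absurd h₀ hpos.ne'
    · rw [orient_swap, h₀, neg_zero] at hpos
      exact absurd hpos (lt_irrefl 0)

theorem MeetsOnlyAt.mem_rim_of_mem_triangle {hs rim} {a b u v w : ℤ × ℤ}
    (h : MeetsOnlyAt hs [u, v, w] rim a b) (huvw : 0 < orient u v w)
    (hp : p ∈ triangle (pt u) (pt v) (pt w))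
    (hhs : ∀ f ∈ hs, 0 ≤ orient (pt f.1) (pt f.2) p) (hab : p ∈ segment ℝ (pt a) (pt b)) :
    ∃ r ∈ rim, pt r = p := by
  refine h.mem_rim ?_ hhs hab
  have hK : pt '' {x | x ∈ [u, v, w]} = {pt u, pt v, pt w} := by
    ext; simp [eq_comm]
  exact hK ▸ triangle_subset_convexHull (orient_pt_pos.2 huvw) hp

/-- A certificate for `SightCone`. -/
def SightConeCert (V : Fin (m + 1) → ℤ × ℤ) (s k : Fin (m + 1)) (q : ℤ × ℤ) : Prop :=
  orient (V (s + 1)) (V (s + 1 + 1)) q = 0 ∧ 0 < orient (V s) (V (s + 1)) q ∧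
  0 < orient (V (s + 1 + 1)) (V s) q ∧
  0 < orient q (V (s + 1 + 1)) (V (s + 1 + 1 + 1)) ∧ 0 < orient q (V (s + 1 + 1 + 1)) (V s) ∧
  0 < orient q (V k) (V (k + 1)) ∧
  (0 < orient q (V k) (V (s + 1 + 1 + 1)) ∧ 0 < orient q (V k) (V s)) ∧
  (0 < orient (V (k + 1)) q (V (s + 1 + 1 + 1)) ∧ 0 < orient (V (k + 1)) q (V s)) ∧
  ∀ j, j ∈ [s, s + 1, s + 1 + 1] ∨
    MeetsOnlyAt [(V s, V (s + 1)), (V (s + 1), q), (q, V s)] [V s, V (s + 1), q] [V s]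
      (V j) (V (j + 1)) ∧
    MeetsOnlyAt [(q, V (s + 1 + 1)), (V (s + 1 + 1), V (s + 1 + 1 + 1)), (V (s + 1 + 1 + 1), q)]
      [q, V (s + 1 + 1), V (s + 1 + 1 + 1)] [V (s + 1 + 1 + 1)] (V j) (V (j + 1)) ∧
    (j = k ∨ MeetsOnlyAt [(q, V (s + 1 + 1 + 1)), (V s, q), (V k, V (k + 1))]
      [q, V k, V (k + 1)] [V s, V (s + 1 + 1 + 1), V k, V (k + 1)] (V j) (V (j + 1)))

instance (k : Fin (m + 1)) (q : ℤ × ℤ) : Decidable (SightConeCert V s k q) := by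
  unfold SightConeCert; infer_instance

theorem mem_openSegment_of_orient (h : orient a b p = 0) (ha : 0 < orient c a p)
    (hb : 0 < orient b c p) : p ∈ openSegment ℝ a b := by
  have hsum := orient_add_orient_add_orient a b c p
  rw [h, add_zero] at hsum
  have hpos : 0 < orient a b c := hsum ▸ add_pos hb ha
  rw [eq_lineMap_of_orient_eq_zero hpos.ne' h]
  exact lineMap_mem_openSegment ⟨div_pos ha hpos, (div_lt_one hpos).2 (by linarith)⟩

theorem mem_threeEdges_of_mem_segment {j : Fin (m + 1)} (hj : j ∈ [s, s + 1, s + 1 + 1])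
    (hp : p ∈ segment ℝ (P j) (P (j + 1))) : p ∈ P.threeEdges s := by
  simp only [List.mem_cons, List.not_mem_nil, or_false] at hj
  rw [threeEdges_eq]
  rcases hj with rfl | rfl | rfl
  exacts [.inl (.inl hp), .inl (.inr hp), .inr hp]

theorem SightConeCert.sightCone {k : Fin (m + 1)} {q : ℤ × ℤ} (h : SightConeCert V s k q) :
    SightCone (intPolygon V) s k (pt q) := by
  obtain ⟨hq, hfirst, hbase, hlast, hmouth, hfront, hright, hleft, hedges⟩ := h
  have hV₀ : pt (V s) ∈ (intPolygon V).threeEdges s := by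
    rw [threeEdges_eq]; exact .inl (.inl (left_mem_segment ℝ _ _))
  have hV₃ : pt (V (s + 1 + 1 + 1)) ∈ (intPolygon V).threeEdges s := by
    rw [threeEdges_eq]; exact .inr (right_mem_segment ℝ _ _)
  refine ⟨?_, orient_pt_pos.2 hmouth, ?_, ?_, ?_, ?_, ?_, ?_⟩
  · exact mem_openSegment_of_orient (by simp [orient_pt, hq]) (orient_pt_pos.2 hfirst)
      (orient_pt_pos.2 hbase)
  · rw [orient_rotate]; exact orient_pt_pos.2 hfront
  · exact hright.imp orient_pt_pos.2 orient_pt_pos.2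
  · exact hleft.imp orient_pt_pos.2 orient_pt_pos.2
  · rintro p ⟨hp, hpP⟩
    obtain ⟨j, hpj⟩ := mem_boundary_iff.1 hpP
    obtain hj | ⟨h, -, -⟩ := hedges j
    · exact mem_threeEdges_of_mem_segment hj hpj
    · obtain ⟨r, hr, rfl⟩ := h.mem_rim_of_mem_triangle hfirst hp
        (by simpa [triangle] using hp) hpj
      exact List.mem_singleton.1 hr ▸ hV₀
  · rintro p ⟨hp, hpP⟩
    obtain ⟨j, hpj⟩ := mem_boundary_iff.1 hpP
    obtain hj | ⟨-, h, -⟩ := hedges j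
    · exact mem_threeEdges_of_mem_segment hj hpj
    · obtain ⟨r, hr, rfl⟩ := h.mem_rim_of_mem_triangle hlast hp
        (by simpa [triangle] using hp) hpj
      exact List.mem_singleton.1 hr ▸ hV₃
  · rintro p ⟨⟨hp, hpP⟩, hp'⟩
    obtain ⟨j, hpj⟩ := mem_boundary_iff.1 hpP
    obtain hj | ⟨-, -, rfl | h⟩ := hedges j
    · exact .inl (mem_threeEdges_of_mem_segment hj hpj)
    · exact .inr hpj
    · obtain ⟨r, hr, rfl⟩ := h.mem_rim_of_mem_triangle hfront hp
        (by simpa using ⟨hp'.1, hp'.2, hp.2.1⟩) hpj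
      simp only [List.mem_cons, List.not_mem_nil, or_false] at hr
      rcases hr with rfl | rfl | rfl | rfl
      exacts [.inl hV₀, .inl hV₃, .inr (left_mem_segment ℝ _ _), .inr (right_mem_segment ℝ _ _)]

end Polygon

end Plane

/-! ### Alternating sets -/

theorem encard_setOf_inter_nonempty_le {α ι : Type*} {Z : ι → Set α}
    (hZ : Pairwise (Function.onFun Disjoint Z)) (G : Set α) :
    {k | (G ∩ Z k).Nonempty}.encard ≤ G.encard := by
  cases isEmpty_or_nonempty α
  · simp [eq_empty_of_isEmpty G]
  choose! f hf using fun k (hk : (G ∩ Z k).Nonempty) => hk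
  refine encard_le_encard_of_injOn (f := f) (fun k hk => (hf k hk).1) fun k hk l hl hkl => ?_
  by_contra hne
  exact disjoint_left.1 (hZ hne) (hf k hk).2 (hkl ▸ (hf l hl).2)

theorem forall_inter_nonempty_of_encard_le {α : Type*} {n : ℕ} {A : Fin (n + 1) → Set α}
    {B : Fin n → Set α} {G : Set α} (hAB : Pairwise (Function.onFun Disjoint (Sum.elim A B)))
    (hG : G.encard ≤ n) (hl : ∀ i, (G ∩ A i.castSucc).Nonempty ∨ (G ∩ B i).Nonempty)
    (hr : ∀ i, (G ∩ A i.succ).Nonempty ∨ (G ∩ B i).Nonempty) (i : Fin n) :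
    (G ∩ B i).Nonempty := by
  classical
  by_contra hi
  set a : Finset (Fin (n + 1)) := {k | (G ∩ A k).Nonempty} with ha
  set b : Finset (Fin n) := {k | (G ∩ B k).Nonempty} with hb
  have hab : a.card + b.card ≤ n := by
    have h := (encard_setOf_inter_nonempty_le hAB G).trans hG
    rw [← Finset.card_disjSum, ← Nat.cast_le (α := ℕ∞), ← encard_coe_eq_coe_finsetCard]
    convert h using 2
    ext (k | k) <;> simp [ha, hb]
  -- The indices outside `b` and the successor of the largest of them all belong to `a`.
  have hbc : bᶜ.Nonempty := ⟨i, by simp [hb, hi]⟩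
  have hsub : bᶜ.map Fin.castSuccEmb ⊂ a := by
    refine (Finset.ssubset_iff_of_subset fun k hk => ?_).2 ⟨(bᶜ.max' hbc).succ, ?_, fun h => ?_⟩
    · obtain ⟨j, hj, rfl⟩ := Finset.mem_map.1 hk
      simpa [ha] using (hl j).resolve_right (by simpa [hb] using hj)
    · simpa [ha] using (hr _).resolve_right (by simpa [hb] using Finset.max'_mem _ hbc)
    · obtain ⟨j, hj, hj'⟩ := Finset.mem_map.1 h
      exact (Fin.castSucc_lt_succ_iff.2 (Finset.le_max' _ j hj)).ne hj'
  have hcard := Finset.card_lt_card hsub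
  rw [Finset.card_map, Finset.card_compl, Fintype.card_fin] at hcard
  have := b.card_le_univ
  rw [Fintype.card_fin] at this
  lia

theorem exists_eq_range_of_encard_le {α : Type*} {n : ℕ} {B : Fin n → Set α} {G : Set α}
    (hB : Pairwise (Function.onFun Disjoint B)) (hG : G.encard ≤ n)
    (h : ∀ i, (G ∩ B i).Nonempty) : ∃ g : Fin n → α, (∀ i, g i ∈ B i) ∧ G = range g := by
  choose g hgG hgB using h
  have hg : Function.Injective g := fun i j hij => by
    by_contra hne
    exact disjoint_left.1 (hB hne) (hgB i) (hij ▸ hgB j)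
  refine ⟨g, hgB, ((finite_range g).eq_of_subset_of_encard_le (range_subset_iff.2 hgG) ?_).symm⟩
  rw [← image_univ, hg.encard_image, encard_univ]
  simpa using hG

/-! ### The gallery -/

/-- The vertices of the gallery in counterclockwise order. -/
def vertex : Fin (25 + 1) → ℤ × ℤ :=
  ![(-1500, 0), (-720, 0), (1040, -3080), (981, -3594), (938, -5572), (1080, -3360),
    (1590, -1980), (1230, -1260), (1620, 453), (2400, 597), (2400, 603), (1740, 490), (1980, 600),
    (2964, 760), (6669, 1710), (3000, 1200), (1800, 1500), (1883, 1530), (1971, 1610),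
    (1860, 1560), (1530, 1860), (1200, 1200), (-2760, 1680), (-3250, 2100), (-4626, 3060),
    (-3000, 1800)]

/-- The triangles of a triangulation of the gallery. -/
def triangles : Fin 24 → Fin 3 → Fin (25 + 1) :=
  ![![25, 0, 1], ![2, 3, 4], ![2, 4, 5], ![2, 5, 6], ![1, 2, 6], ![1, 6, 7], ![25, 1, 7],
    ![8, 9, 10], ![8, 10, 11], ![8, 11, 12], ![12, 13, 14], ![12, 14, 15], ![8, 12, 15],
    ![8, 15, 16], ![7, 8, 16], ![16, 17, 18], ![16, 18, 19], ![16, 19, 20], ![7, 16, 20],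
    ![7, 20, 21], ![7, 21, 22], ![25, 7, 22], ![25, 22, 23], ![23, 24, 25]]

/-- The art gallery. -/
def gallery : Polygon (ℝ × ℝ) (25 + 1) := intPolygon vertex

/-- The nooks of the gallery. The first one only serves to force a guard onto a certain edge, the
other ones also simulate the four constraints. -/
def nook : Fin 5 → Fin (25 + 1) := ![8, 22, 2, 16, 12]

/-- The edges of the gallery that have to be occupied by guards: the first one by the guard `X`, the
second one by `Z`, and the third one by `Y`. In this order, the edge `i` lies opposite to both of
the nooks `i` and `i + 1`. -/
def guardEdge : Fin 3 → Fin (25 + 1) := ![0, 6, 20]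

/-- The end points of the segments to which the three guards are confined. -/
def guardRange : Fin 3 → Fin 2 → ℤ × ℤ :=
  ![![(-840, 0), (-900, 0)], ![(1320, -1440), (1350, -1500)], ![(1320, 1440), (1350, 1500)]]

/-- The first of the two guards between which a nook simulates a constraint. -/
def leftGuard : Fin 4 → Fin 3 := ![0, 1, 2, 2]

/-- The second of the two guards between which a nook simulates a constraint. -/
def rightGuard : Fin 4 → Fin 3 := ![1, 2, 0, 0]

/-- The guard that does not take part in the constraint simulated by a nook. -/
def otherGuard : Fin 4 → Fin 3 := ![2, 0, 1, 1]

/-- Directions in which one can escape to infinity from the walls of the nooks. -/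
def wallEscape : Fin 5 → Fin 3 → ℤ × ℤ :=
  ![![(1, 0), (1, 0), (5, 1)], ![(0, 1), (0, 1), (-4, 3)], ![(-1, 0), (-1, 0), (-1, -20)],
    ![(3, 1), (2, 1), (2, 1)], ![(7, 1), (0, -1), (4, 1)]]

/-- Directions in which one can escape to infinity from the edges occupied by guards. -/
def guardEscape : Fin 3 → ℤ × ℤ := ![(0, -1), (1, 0), (0, 1)]

theorem triangulationCert : TriangulationCert vertex triangles := by decide +kernel

theorem isSimplePlane_gallery : gallery.IsSimplePlane :=
  isSimplePlane_intPolygon (by norm_num) (by decide +kernel) (by decide +kernel) (by decide +kernel)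

theorem isNook_gallery (j : Fin 4) : gallery.IsNook (nook j.succ) :=
  HullCert.isNook triangulationCert <|
    (show ∀ j : Fin 4, HullCert vertex triangles ![vertex (nook j.succ),
      vertex (nook j.succ + 1 + 1 + 1)] by decide +kernel) j

theorem isOpaqueNook_gallery (k : Fin 5) : IsOpaqueNook gallery (nook k) (pt ∘ wallEscape k) :=
  OpaqueNookCert.isOpaqueNook <|
    (show ∀ k, OpaqueNookCert vertex (nook k) (wallEscape k) by decide +kernel) k

theorem isEscape_guardEdge (i : Fin 3) : IsEscape gallery (guardEdge i) (pt (guardEscape i)) :=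
  EscapeCert.isEscape <|
    (show ∀ i, EscapeCert vertex (guardEdge i) (guardEscape i) by decide +kernel) i

theorem edgesApart_nook : ∀ k l, k ≠ l →
    ∀ i ∈ [nook k, nook k + 1, nook k + 1 + 1], ∀ j ∈ [nook l, nook l + 1, nook l + 1 + 1],
      EdgesApart vertex i j := by
  decide +kernel

theorem disjoint_threeEdges_gallery {k l : Fin 5} (h : k ≠ l) :
    Disjoint (gallery.threeEdges (nook k)) (gallery.threeEdges (nook l)) :=
  disjoint_threeEdges (edgesApart_nook k l h)

theorem edgesApart_guardEdge : ∀ k l, k ≠ l → EdgesApart vertex (guardEdge k) (guardEdge l) := by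
  decide +kernel

theorem edgesApart_nook_guardEdge : ∀ k l, ∀ i ∈ [nook k, nook k + 1, nook k + 1 + 1],
    EdgesApart vertex i (guardEdge l) := by
  decide +kernel

theorem lookIntoCert_gallery : ∀ j : Fin 4, LookIntoCert vertex triangles (nook j.succ)
    (guardRange (leftGuard j)) (guardRange (rightGuard j)) := by
  decide +kernel

theorem hidesBaseCert_gallery : ∀ j : Fin 4, HidesBaseCert vertex (nook j.succ)
    ![vertex (guardEdge (leftGuard j)), vertex (guardEdge (leftGuard j) + 1)]
    ![vertex (guardEdge (rightGuard j)), vertex (guardEdge (rightGuard j) + 1)] := by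
  decide +kernel

theorem base_behind_otherGuard : ∀ j : Fin 4,
    ∀ i ∈ [nook j.succ + 1, nook j.succ + 1 + 1], orient (vertex (guardEdge (otherGuard j)))
      (vertex (guardEdge (otherGuard j) + 1)) (vertex i) < 0 := by
  decide +kernel

theorem mem_nook_or_seen_edge : ∀ j : Fin (25 + 1),
    (∃ k : Fin 4, j ∈ [nook k.succ, nook k.succ + 1, nook k.succ + 1 + 1]) ∨
    ∃ i, j = guardEdge i ∨ HullCert vertex triangles
      ![guardRange i 0, guardRange i 1, vertex j, vertex (j + 1)] := by
  decide +kernel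

/-- Points on the bases of the nooks `i` and `i + 1` that see the edge occupied by the guard `i`. -/
def lookout : Fin 3 → Fin 2 → ℤ × ℤ :=
  ![![(2400, 600), (-3293, 2130)], ![(-4497, 2970), (980, -3640)], ![(940, -5480), (1894, 1540)]]

theorem sightCone_lookout_zero (i : Fin 3) :
    SightCone gallery (nook i.castSucc.castSucc) (guardEdge i) (pt (lookout i 0)) :=
  SightConeCert.sightCone <| (show ∀ i : Fin 3, SightConeCert vertex (nook i.castSucc.castSucc)
    (guardEdge i) (lookout i 0) by decide +kernel) i

theorem sightCone_lookout_one (i : Fin 3) :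
    SightCone gallery (nook i.castSucc.succ) (guardEdge i) (pt (lookout i 1)) :=
  SightConeCert.sightCone <| (show ∀ i : Fin 3, SightConeCert vertex (nook i.castSucc.succ)
    (guardEdge i) (lookout i 1) by decide +kernel) i

/-! ### The guards -/

/-- The guards as functions of the values they represent. -/
noncomputable def guard : Fin 3 → ℝ → ℝ × ℝ := ![guardX 600, guardZ 600, guardY 600]

variable {a b g p : ℝ × ℝ} {t x y z : ℝ} {w : Fin 3 → ℝ}

theorem guard_zero (x : ℝ) : guard 0 x = (-600 * x, 0) := by
  ext <;> simp [guard, guardX]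

theorem guard_one (z : ℝ) : guard 1 z = (900 + 300 * z, -600 - 600 * z) := by
  ext <;> simp [guard, guardZ] <;> ring

theorem guard_two (y : ℝ) : guard 2 y = (900 + 300 * y, 600 + 600 * y) := by
  ext <;> simp [guard, guardY] <;> ring

theorem exists_affineMap_eq_guard (i : Fin 3) : ∃ f : ℝ →ᵃ[ℝ] ℝ × ℝ, ⇑f = guard i := by
  refine ⟨lineMap (guard i 0) (guard i 1), funext fun t => ?_⟩
  match i with
  | 0 => ext <;> simp [lineMap_apply, guard_zero]; ring
  | 1 => ext <;> simp [lineMap_apply, guard_one] <;> ring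
  | 2 => ext <;> simp [lineMap_apply, guard_two] <;> ring

theorem image_guard_segment (i : Fin 3) (r s : ℝ) :
    guard i '' segment ℝ r s = segment ℝ (guard i r) (guard i s) := by
  obtain ⟨f, hf⟩ := exists_affineMap_eq_guard i
  exact hf ▸ image_segment ℝ f r s

theorem image_guard_openSegment (i : Fin 3) (r s : ℝ) :
    guard i '' openSegment ℝ r s = openSegment ℝ (guard i r) (guard i s) := by
  obtain ⟨f, hf⟩ := exists_affineMap_eq_guard i
  exact hf ▸ image_openSegment ℝ f r s

theorem guard_mem_guardRange (i : Fin 3) (ht : t ∈ Icc (7 / 5) (3 / 2)) :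
    guard i t ∈ segment ℝ (pt (guardRange i 0)) (pt (guardRange i 1)) := by
  have h : guard i (7 / 5) = pt (guardRange i 0) ∧ guard i (3 / 2) = pt (guardRange i 1) := by
    match i with
    | 0 => norm_num [guard_zero, guardRange, pt]
    | 1 => norm_num [guard_one, guardRange, pt]
    | 2 => simp [guard_two, guardRange, pt]; norm_num
  rw [← h.1, ← h.2, ← image_guard_segment, segment_eq_Icc (by norm_num)]
  exact mem_image_of_mem _ ht

/-- The edge that has to be occupied by the guard `i`, without its ends. -/
def guardWall (i : Fin 3) : Set (ℝ × ℝ) :=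
  openSegment ℝ (gallery (guardEdge i)) (gallery (guardEdge i + 1))

theorem exists_image_guard_Ioo_eq_guardWall (i : Fin 3) :
    ∃ r s : ℝ, 0 < r ∧ r < 7 / 5 ∧ 3 / 2 < s ∧ s < 4 ∧ guard i '' Ioo r s = guardWall i := by
  suffices ∃ r s : ℝ, 0 < r ∧ r < 7 / 5 ∧ 3 / 2 < s ∧ s < 4 ∧
      guard i s = gallery (guardEdge i) ∧ guard i r = gallery (guardEdge i + 1) by
    obtain ⟨r, s, h₀, hr, hs, h₄, hs', hr'⟩ := this
    refine ⟨r, s, h₀, hr, hs, h₄, ?_⟩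
    rw [guardWall, openSegment_symm, ← hr', ← hs', ← image_guard_openSegment,
      openSegment_eq_Ioo (by linarith)]
  match i with
  | 0 =>
    refine ⟨6 / 5, 5 / 2, by norm_num, by norm_num, by norm_num, by norm_num, ?_⟩
    change guard 0 (5 / 2) = pt (-1500, 0) ∧ guard 0 (6 / 5) = pt (-720, 0)
    norm_num [guard_zero, pt]
  | 1 =>
    refine ⟨11 / 10, 23 / 10, by norm_num, by norm_num, by norm_num, by norm_num, ?_⟩
    change guard 1 (23 / 10) = pt (1590, -1980) ∧ guard 1 (11 / 10) = pt (1230, -1260)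
    norm_num [guard_one, pt]
  | 2 =>
    refine ⟨1, 21 / 10, by norm_num, by norm_num, by norm_num, by norm_num, ?_⟩
    change guard 2 (21 / 10) = pt (1530, 1860) ∧ guard 2 1 = pt (1200, 1200)
    norm_num [guard_two, pt]

theorem exists_guard_eq_of_mem_guardWall {i : Fin 3} (hg : g ∈ guardWall i) :
    ∃ t ∈ Ioo 0 4, guard i t = g := by
  obtain ⟨r, s, hr, -, -, hs, h⟩ := exists_image_guard_Ioo_eq_guardWall i
  obtain ⟨t, ht, rfl⟩ := h.symm ▸ hg
  exact ⟨t, Ioo_subset_Ioo hr.le hs.le ht, rfl⟩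

theorem guard_mem_guardWall (i : Fin 3) (ht : t ∈ Icc (7 / 5) (3 / 2)) :
    guard i t ∈ guardWall i := by
  obtain ⟨r, s, -, hr, hs, -, h⟩ := exists_image_guard_Ioo_eq_guardWall i
  exact h ▸ mem_image_of_mem _ (Icc_subset_Ioo hr hs ht)

/-! ### The constraints -/

theorem nookIdentity_x_z : NookIdentity gallery 22 (guard 0 x) (guard 1 z) (x - z) := by
  refine ⟨1, one_pos, 15 / 14, by norm_num, 180000, by norm_num, 756000, by norm_num, ?_⟩
  change 1 * orient (guard 0 x) (pt (-3000, 1800)) (pt (-3250, 2100)) =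
      15 / 14 * orient (guard 1 z) (pt (-2760, 1680)) (pt (-3250, 2100)) + (x - z) * 180000 ∧
    1 * orient (guard 0 x) (pt (-3000, 1800)) (pt (-4626, 3060)) =
      15 / 14 * orient (guard 1 z) (pt (-2760, 1680)) (pt (-4626, 3060)) + (x - z) * 756000
  constructor <;> simp [guard_zero, guard_one, orient, pt] <;> ring

theorem nookIdentity_z_y : NookIdentity gallery 2 (guard 1 z) (guard 2 y) (z - y) := by
  refine ⟨1, one_pos, 12 / 11, by norm_num, 129600, by norm_num, 748800, by norm_num, ?_⟩
  change 1 * orient (guard 1 z) (pt (1080, -3360)) (pt (981, -3594)) =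
      12 / 11 * orient (guard 2 y) (pt (1040, -3080)) (pt (981, -3594)) + (z - y) * 129600 ∧
    1 * orient (guard 1 z) (pt (1080, -3360)) (pt (938, -5572)) =
      12 / 11 * orient (guard 2 y) (pt (1040, -3080)) (pt (938, -5572)) + (z - y) * 748800
  constructor <;> simp [guard_one, guard_two, orient, pt] <;> ring

theorem nookIdentity_y_x (hx : -4 < x) :
    NookIdentity gallery 16 (guard 2 y) (guard 0 x) (y * (x + 4) - (4 * x + 2)) := by
  refine ⟨x + 4, by linarith, 56 / 25, by norm_num, 22800, by norm_num, 51600, by norm_num, ?_⟩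
  change (x + 4) * orient (guard 2 y) (pt (1860, 1560)) (pt (1883, 1530)) =
      56 / 25 * orient (guard 0 x) (pt (1800, 1500)) (pt (1883, 1530)) +
        (y * (x + 4) - (4 * x + 2)) * 22800 ∧
    (x + 4) * orient (guard 2 y) (pt (1860, 1560)) (pt (1971, 1610)) =
      56 / 25 * orient (guard 0 x) (pt (1800, 1500)) (pt (1971, 1610)) +
        (y * (x + 4) - (4 * x + 2)) * 51600
  constructor <;> simp [guard_zero, guard_two, orient, pt] <;> ring

theorem nookIdentity_y_neg_x (hx : x < 4) :
    NookIdentity gallery 12 (guard 2 y) (guard 0 x) (y * (-x + 4) - (4 * x - 2)) := by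
  refine ⟨-x + 4, by linarith, 14, by norm_num, 110400, by norm_num, 2048400, by norm_num, ?_⟩
  change (-x + 4) * orient (guard 2 y) (pt (3000, 1200)) (pt (2964, 760)) =
      14 * orient (guard 0 x) (pt (1980, 600)) (pt (2964, 760)) +
        (y * (-x + 4) - (4 * x - 2)) * 110400 ∧
    (-x + 4) * orient (guard 2 y) (pt (3000, 1200)) (pt (6669, 1710)) =
      14 * orient (guard 0 x) (pt (1980, 600)) (pt (6669, 1710)) +
        (y * (-x + 4) - (4 * x - 2)) * 2048400
  constructor <;> simp [guard_zero, guard_two, orient, pt] <;> ring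

/-- The constraint simulated by the nook `j.succ` when the guards represent the values `w 0`, `w 1`
and `w 2` of `x`, `z` and `y`: it is that this number is at most zero. -/
def excess (w : Fin 3 → ℝ) : Fin 4 → ℝ :=
  ![w 0 - w 1, w 1 - w 2, w 2 * (w 0 + 4) - (4 * w 0 + 2), w 2 * (-w 0 + 4) - (4 * w 0 - 2)]

theorem excess_nonpos_iff (h₁ : -4 < w 0) (h₂ : w 0 < 4) (j : Fin 4) :
    excess w j ≤ 0 ↔ ![w 1 ≥ w 0, w 2 ≥ w 1, (4 * w 0 + 2) / (w 0 + 4) ≥ w 2,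
      (4 * w 0 - 2) / (-w 0 + 4) ≥ w 2] j := by
  have h₁' : 0 < w 0 + 4 := by linarith
  have h₂' : 0 < -w 0 + 4 := by linarith
  fin_cases j <;> simp [excess, le_div_iff₀, h₁', h₂']

theorem forall_excess_nonpos_iff (h₁ : -4 < w 0) (h₂ : w 0 < 4) :
    (∀ j, excess w j ≤ 0) ↔ NookConstraints (w 0) (w 2) (w 1) := by
  simp [excess_nonpos_iff h₁ h₂, Fin.forall_fin_succ, NookConstraints]

theorem nookIdentity_gallery (h₁ : -4 < w 0) (h₂ : w 0 < 4) : ∀ j,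
    NookIdentity gallery (nook j.succ) (guard (leftGuard j) (w (leftGuard j)))
      (guard (rightGuard j) (w (rightGuard j))) (excess w j)
  | 0 => nookIdentity_x_z
  | 1 => nookIdentity_z_y
  | 2 => nookIdentity_y_x h₁
  | 3 => nookIdentity_y_neg_x h₂

/-! ### The placement of the guards -/

theorem not_sees_base {j : Fin 4} (hg : g ∈ guardWall (otherGuard j))
    (hp : p ∈ openSegment ℝ (gallery (nook j.succ + 1)) (gallery (nook j.succ + 1 + 1))) :
    ¬ gallery.Sees g p := by
  have h := base_behind_otherGuard j
  exact not_sees_of_orient_neg (isEscape_guardEdge _) hg <|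
    orient_neg_of_mem_segment (h _ (by simp)) (h _ (by simp)) (openSegment_subset_segment ℝ _ _ hp)

theorem hidesBase_gallery {j : Fin 4} {e : ℝ} (ha : a ∈ guardWall (leftGuard j))
    (hb : b ∈ guardWall (rightGuard j)) (hi : NookIdentity gallery (nook j.succ) a b e)
    (he : 0 < e) : HidesBase gallery (nook j.succ) a b :=
  (hidesBaseCert_gallery j).hidesBase hi he (openSegment_subset_segment ℝ _ _ ha)
    (openSegment_subset_segment ℝ _ _ hb)

theorem nookImposes_gallery (hw : ∀ i, w i ∈ Icc (7 / 5) (3 / 2)) (j : Fin 4) :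
    gallery.NookImposes (nook j.succ) (guard (leftGuard j) (w (leftGuard j)))
      (guard (rightGuard j) (w (rightGuard j))) (guard (otherGuard j) (w (otherGuard j)))
      (excess w j ≤ 0) := by
  have hwall (i : Fin 3) := guard_mem_guardWall i (hw i)
  have hi := nookIdentity_gallery (by linarith [(hw 0).1]) (by linarith [(hw 0).2]) j
  exact nookImposes (isOpaqueNook_gallery j.succ)
    ((lookIntoCert_gallery j).lookInto triangulationCert (guard_mem_guardRange _ (hw _))
      (guard_mem_guardRange _ (hw _)))
    (hidesBase_gallery (hwall _) (hwall _) hi) hi fun _ => not_sees_base (hwall _)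

theorem range_eq_guards {α : Type*} (f : Fin 3 → α) (j : Fin 4) :
    range f = {f (leftGuard j), f (rightGuard j), f (otherGuard j)} := by
  have h : ∀ j i, i = leftGuard j ∨ i = rightGuard j ∨ i = otherGuard j := by decide
  refine Subset.antisymm (range_subset_iff.2 fun i => ?_) (by simp [insert_subset_iff])
  rcases h j i with rfl | rfl | rfl <;> simp

theorem excess_nonpos_of_guards (h₁ : -4 < w 0) (h₂ : w 0 < 4)
    (hw : ∀ i, guard i (w i) ∈ guardWall i) {j : Fin 4}
    (hG : gallery.Guards (range fun i => guard i (w i)) (gallery.threeEdges (nook j.succ))) :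
    excess w j ≤ 0 := by
  have hi := nookIdentity_gallery h₁ h₂ j
  by_contra! he
  refine not_guards_of_pos (isOpaqueNook_gallery j.succ)
    (hidesBase_gallery (hw _) (hw _) hi he) hi he (fun _ => not_sees_base (hw (otherGuard j))) ?_
  rwa [range_eq_guards _ j] at hG

theorem isBoundaryGuarding_of_excess_nonpos (hw : ∀ i, w i ∈ Icc (7 / 5) (3 / 2))
    (h : ∀ j, excess w j ≤ 0) :
    gallery.IsBoundaryGuarding (range fun i => guard i (w i)) := by
  have hwall (i : Fin 3) : guard i (w i) ∈ segment ℝ (gallery (guardEdge i)) _ :=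
    openSegment_subset_segment ℝ _ _ (guard_mem_guardWall i (hw i))
  refine ⟨range_subset_iff.2 fun i => edge_subset_boundary _ _ (hwall i), fun p hp => ?_⟩
  obtain ⟨k, hk⟩ := mem_boundary_iff.1 hp
  obtain ⟨j, hj⟩ | ⟨i, rfl | hi⟩ := mem_nook_or_seen_edge k
  · rw [range_eq_guards _ j]
    exact (nookImposes_gallery hw j).2.2 (h j) p (mem_threeEdges_of_mem_segment hj hk)
  · exact ⟨_, mem_range_self i, ((convex_segment _ _).segment_subset (hwall i) hk).trans
      ((edge_subset_boundary gallery _).trans fun _ => .inl)⟩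
  · refine ⟨_, mem_range_self i, sees_of_convexHull_subset (hi.convexHull_insert_subset
      triangulationCert (guard_mem_guardRange i (hw i))) (subset_convexHull ℝ _ (by simp)) ?_⟩
    exact segment_subset_convexHull (x := gallery k) (y := gallery (k + 1))
      (by simp [gallery]) (by simp [gallery]) hk

theorem pairwise_disjoint_threeEdges_guardWall : Pairwise (Function.onFun Disjoint (Sum.elim
    (fun k : Fin 4 => gallery.threeEdges (nook k.castSucc)) guardWall)) := by
  have hwall (i : Fin 3) : guardWall i ⊆ segment ℝ (pt _) (pt _) := openSegment_subset_segment ℝ _ _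
  have hmix (k : Fin 4) (i : Fin 3) :
      Disjoint (gallery.threeEdges (nook k.castSucc)) (guardWall i) := by
    have h := edgesApart_nook_guardEdge k.castSucc i
    rw [threeEdges_eq]
    refine .mono_right (hwall i) (.union_left (.union_left ?_ ?_) ?_) <;>
      exact (h _ (by simp)).disjoint
  rintro (k | k) (l | l) hkl
  · exact disjoint_threeEdges_gallery (by simpa using hkl)
  · exact hmix k l
  · exact (hmix l k).symm
  · exact .mono (hwall k) (hwall l) (edgesApart_guardEdge k l (by simpa using hkl)).disjoint

theorem exists_eq_range_guard {G : Set (ℝ × ℝ)} (hcard : G.encard ≤ 3)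
    (hG : gallery.IsBoundaryGuarding G) :
    ∃ w : Fin 3 → ℝ, (∀ i, w i ∈ Ioo 0 4) ∧ (∀ i, guard i (w i) ∈ guardWall i) ∧
      G = range fun i => guard i (w i) := by
  have hd := pairwise_disjoint_threeEdges_guardWall
  obtain ⟨g, hg, rfl⟩ := exists_eq_range_of_encard_le (B := guardWall)
    (hd.comp_of_injective Sum.inr_injective) hcard <|
    forall_inter_nonempty_of_encard_le hd hcard
      (fun i => (sightCone_lookout_zero i).inter_nonempty (isOpaqueNook_gallery _)
        (isEscape_guardEdge i) hG)
      fun i => (sightCone_lookout_one i).inter_nonempty (isOpaqueNook_gallery _)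
        (isEscape_guardEdge i) hG
  choose w hw hwg using fun i => exists_guard_eq_of_mem_guardWall (hg i)
  exact ⟨w, hw, fun i => (hwg i).symm ▸ hg i, congrArg range (funext hwg).symm⟩

/-! ### The solutions of the constraints -/

theorem nookConstraints_iff (h₁ : -4 < x) (h₂ : x < 4) : NookConstraints x y z ↔
    (x = √2 ∧ y = √2 ∧ z = √2) ∨ (x = -√2 ∧ y = -√2 ∧ z = -√2) := by
  have hs : √2 ^ 2 = 2 := Real.sq_sqrt zero_le_two
  have hs₀ : 0 ≤ √2 := Real.sqrt_nonneg 2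
  have hx₁ : 0 < x + 4 := by linarith
  have hx₂ : 0 < -x + 4 := by linarith
  simp only [NookConstraints, ge_iff_le, le_div_iff₀ hx₁, le_div_iff₀ hx₂]
  constructor
  · rintro ⟨hxz, hzy, hy₁, hy₂⟩
    have hxy := hxz.trans hzy
    have hle : x ^ 2 ≤ 2 := by linarith [mul_le_mul_of_nonneg_right hxy hx₁.le]
    have hge : 2 ≤ x ^ 2 := by linarith [mul_le_mul_of_nonneg_right hxy hx₂.le]
    have hx := hle.antisymm hge
    have hyx : y ≤ x := le_of_mul_le_mul_right (by linarith) hx₁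
    obtain rfl : y = x := hyx.antisymm hxy
    obtain rfl : z = y := hzy.antisymm hxz
    simpa using sq_eq_sq_iff_eq_or_eq_neg.1 (hx.trans hs.symm)
  · rintro (⟨rfl, rfl, rfl⟩ | ⟨rfl, rfl, rfl⟩) <;>
      exact ⟨le_rfl, le_rfl, by linarith, by linarith⟩

theorem nookConstraints_iff_of_pos (h₁ : 0 < x) (h₂ : x < 4) :
    NookConstraints x y z ↔ x = √2 ∧ y = √2 ∧ z = √2 := by
  rw [nookConstraints_iff (by linarith) h₂, or_iff_left]
  rintro ⟨h, -⟩
  linarith [Real.sqrt_nonneg 2]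

theorem sqrt_two_mem_Ioo : √2 ∈ Ioo (7 / 5 : ℝ) (3 / 2) :=
  ⟨Real.lt_sqrt_of_sq_lt (by norm_num), (Real.sqrt_lt' (by norm_num)).2 (by norm_num)⟩

theorem range_guard (w : Fin 3 → ℝ) :
    range (fun i => guard i (w i)) = {guardX 600 (w 0), guardY 600 (w 2), guardZ 600 (w 1)} := by
  rw [range_eq_guards _ 3, insert_comm]
  rfl

theorem isBoundaryGuarding_iff {G : Set (ℝ × ℝ)} (hcard : G.encard ≤ 3) :
    gallery.IsBoundaryGuarding G ↔ G = {guardX 600 √2, guardY 600 √2, guardZ 600 √2} := by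
  constructor
  · intro hG
    obtain ⟨w, hw, hwall, rfl⟩ := exists_eq_range_guard hcard hG
    obtain ⟨h₀, h₄⟩ := hw 0
    have h := (forall_excess_nonpos_iff (by linarith) h₄).1 fun j =>
      excess_nonpos_of_guards (by linarith) h₄ hwall fun p hp =>
        hG.2 p (threeEdges_subset_boundary _ _ hp)
    obtain ⟨hx, hy, hz⟩ := (nookConstraints_iff_of_pos h₀ h₄).1 h
    rw [range_guard, hx, hy, hz]
  · rintro rfl
    obtain ⟨h₁, h₂⟩ := sqrt_two_mem_Ioo
    rw [← range_guard fun _ => √2]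
    refine isBoundaryGuarding_of_excess_nonpos (fun _ => ⟨h₁.le, h₂.le⟩) ?_
    exact (forall_excess_nonpos_iff (by linarith) (by linarith)).2
      ((nookConstraints_iff_of_pos (by linarith) (by linarith)).2 ⟨rfl, rfl, rfl⟩)

theorem encard_guards :
    ({guardX 600 √2, guardY 600 √2, guardZ 600 √2} : Set (ℝ × ℝ)).encard = 3 := by
  have h₀ := Real.sqrt_nonneg 2
  refine encard_eq_three.2 ⟨_, _, _, ?_, ?_, ?_, rfl⟩ <;> intro h <;>
    simp only [guardX, guardY, guardZ, Prod.smul_mk, smul_eq_mul, Prod.mk.injEq,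
      Nat.cast_ofNat] at h <;>
    linarith [h.1, h.2]

theorem irrational_of_mem_guards
    (hg : g ∈ ({guardX 600 √2, guardY 600 √2, guardZ 600 √2} : Set (ℝ × ℝ))) :
    Irrational g.1 ∨ Irrational g.2 := by
  have h : Irrational (600 * √2) := by
    simpa using irrational_sqrt_two.ratCast_mul (q := 600) (by norm_num)
  rcases hg with rfl | rfl | rfl
  · exact .inl (by simpa [guardX] using h)
  · refine .inr ?_
    simpa [guardY, mul_add] using h.natCast_add 600
  · refine .inr ?_
    simpa [guardZ, mul_sub] using h.ratCast_sub (-600)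

theorem nookImposes_constraints (hx : x ∈ Icc (7 / 5) (3 / 2)) (hy : y ∈ Icc (7 / 5) (3 / 2))
    (hz : z ∈ Icc (7 / 5) (3 / 2)) :
    gallery.NookImposes (nook 1) (guardX 600 x) (guardZ 600 z) (guardY 600 y) (z ≥ x) ∧
    gallery.NookImposes (nook 2) (guardY 600 y) (guardZ 600 z) (guardX 600 x) (y ≥ z) ∧
    gallery.NookImposes (nook 3) (guardX 600 x) (guardY 600 y) (guardZ 600 z)
      ((4 * x + 2) / (x + 4) ≥ y) ∧
    gallery.NookImposes (nook 4) (guardX 600 x) (guardY 600 y) (guardZ 600 z)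
      ((4 * x - 2) / (-x + 4) ≥ y) := by
  have h := nookImposes_gallery (w := ![x, z, y])
    (by simpa [Fin.forall_fin_succ] using ⟨hx, hz, hy⟩)
  simp only [excess_nonpos_iff (w := ![x, z, y]) (by linarith [hx.1] : -4 < x)
    (by linarith [hx.2] : x < 4)] at h
  exact ⟨h 0, nookImposes_comm.1 (h 1), nookImposes_comm.1 (h 2), nookImposes_comm.1 (h 3)⟩

theorem guard_mem_boundary (i : Fin 3) (ht : t ∈ Icc (7 / 5) (3 / 2)) :
    guard i t ∈ gallery.boundary ℝ :=
  edge_subset_boundary _ _ (openSegment_subset_segment ℝ _ _ (guard_mem_guardWall i ht))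

end ArtGallery

open ArtGallery

theorem mainTheorem7 :
    -- the four constraints, where both denominators are positive, have exactly two solutions
    (∀ x y z : ℝ, -4 < x → x < 4 →
      (NookConstraints x y z ↔
        (x = √2 ∧ y = √2 ∧ z = √2) ∨ (x = -√2 ∧ y = -√2 ∧ z = -√2))) ∧
    -- the art gallery `P`, the scale `N`, the ranges of the three variables and the four nooks
    ∃ (n : ℕ) (P : Polygon (ℝ × ℝ) n) (N : ℕ) (x₀ x₁ y₀ y₁ z₀ z₁ : ℚ) (s : Fin 4 → Fin n),
      P.IsSimplePlane ∧ P.HasIntegerVertices ∧ 0 < N ∧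
      (0 < x₀ ∧ x₁ < 4 ∧ 0 < y₀ ∧ 0 < z₀) ∧
      (√2 ∈ Set.Ioo (x₀ : ℝ) x₁ ∧ √2 ∈ Set.Ioo (y₀ : ℝ) y₁ ∧ √2 ∈ Set.Ioo (z₀ : ℝ) z₁) ∧
      -- the three segments of guard positions lie on the boundary
      (∀ x ∈ Set.Icc (x₀ : ℝ) x₁, guardX N x ∈ P.boundary ℝ) ∧
      (∀ y ∈ Set.Icc (y₀ : ℝ) y₁, guardY N y ∈ P.boundary ℝ) ∧
      (∀ z ∈ Set.Icc (z₀ : ℝ) z₁, guardZ N z ∈ P.boundary ℝ) ∧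
      -- four disjoint nooks, which impose the four constraints
      (∀ i, P.IsNook (s i)) ∧
      (∀ i j, i ≠ j → Disjoint (P.threeEdges (s i)) (P.threeEdges (s j))) ∧
      (∀ x ∈ Set.Icc (x₀ : ℝ) x₁, ∀ y ∈ Set.Icc (y₀ : ℝ) y₁, ∀ z ∈ Set.Icc (z₀ : ℝ) z₁,
        P.NookImposes (s 0) (guardX N x) (guardZ N z) (guardY N y) (z ≥ x) ∧
        P.NookImposes (s 1) (guardY N y) (guardZ N z) (guardX N x) (y ≥ z) ∧
        P.NookImposes (s 2) (guardX N x) (guardY N y) (guardZ N z)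
          ((4 * x + 2) / (x + 4) ≥ y) ∧
        P.NookImposes (s 3) (guardX N x) (guardY N y) (guardZ N z)
          ((4 * x - 2) / (-x + 4) ≥ y)) ∧
      -- at most three boundary guards see the boundary exactly if they are placed on the three
      -- segments, one on each, and represent values that satisfy the four constraints
      (∀ G : Set (ℝ × ℝ), G.encard ≤ 3 →
        (P.IsBoundaryGuarding G ↔
          ∃ x ∈ Set.Icc (x₀ : ℝ) x₁, ∃ y ∈ Set.Icc (y₀ : ℝ) y₁, ∃ z ∈ Set.Icc (z₀ : ℝ) z₁,
            G = {guardX N x, guardY N y, guardZ N z} ∧ NookConstraints x y z)) ∧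
      -- hence there is exactly one such set of guards, given by `x = y = z = √2`
      (∀ G : Set (ℝ × ℝ), G.encard ≤ 3 →
        (P.IsBoundaryGuarding G ↔ G = {guardX N √2, guardY N √2, guardZ N √2})) ∧
      -- three boundary guards suffice, but only with irrational coordinates
      (∃ G : Set (ℝ × ℝ), G.encard = 3 ∧ P.IsBoundaryGuarding G) ∧
      (∀ G : Set (ℝ × ℝ), G.encard ≤ 3 → P.IsBoundaryGuarding G →
        ∀ g ∈ G, Irrational g.1 ∨ Irrational g.2) := by
  obtain ⟨hsqrt, hsqrt'⟩ := sqrt_two_mem_Ioo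
  refine ⟨fun x y z => nookConstraints_iff, 25 + 1, gallery, 600, 7 / 5, 3 / 2, 7 / 5, 3 / 2, 7 / 5,
    3 / 2, fun j => nook j.succ, isSimplePlane_gallery, hasIntegerVertices_intPolygon, ?_⟩
  push_cast
  refine ⟨by norm_num, by norm_num, by simp [hsqrt, hsqrt'], fun x => guard_mem_boundary 0,
    fun y => guard_mem_boundary 2, fun z => guard_mem_boundary 1, isNook_gallery,
    fun i j hij => disjoint_threeEdges_gallery (by simpa using hij),
    fun x hx y hy z hz => nookImposes_constraints hx hy hz, fun G hG => ?_,
    fun G hG => isBoundaryGuarding_iff hG,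
    ⟨_, encard_guards, (isBoundaryGuarding_iff encard_guards.le).2 rfl⟩,
    fun G hG h g hg => irrational_of_mem_guards ((isBoundaryGuarding_iff hG).1 h ▸ hg)⟩
  rw [isBoundaryGuarding_iff hG]
  constructor
  · intro h
    have hs := Set.Ioo_subset_Icc_self sqrt_two_mem_Ioo
    exact ⟨_, hs, _, hs, _, hs, h,
      (nookConstraints_iff_of_pos (by linarith) (by linarith)).2 ⟨rfl, rfl, rfl⟩⟩
  · rintro ⟨x, hx, y, hy, z, hz, rfl, h⟩
    obtain ⟨rfl, rfl, rfl⟩ := (nookConstraints_iff_of_pos (by linarith [hx.1])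
      (by linarith [hx.2])).1 h
    rfl
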